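/- Let $m\ge 1$ be an integer, $q=2^m$, let $\alpha$ be a primitive element of $\mathbb F_{q^2}$, and put $\zeta=\alpha^{q-1}$, an element of order $q+1$. Let $M_q^\perp$ be the cyclic code of length $q+1$ over $\mathbb F_q$ with check polynomial $(x-1)(x-\zeta)(x-\zeta^q)$, that is, the set of the words $c\in\mathbb F_q^{q+1}$ whose polynomial satisfies $c(x)(x-1)(x-\zeta)(x-\zeta^q)\equiv 0 \pmod{x^{q+1}-1}$, and let $M_q$ be its dual. Let $K_q$ be the Kasami code, that is, the binary cyclic code of length $q^2-1$ with the zeros $\alpha$ and $\alpha^{1+q}$ (the set of the words $c\in\mathbb F_2^{q^2-1}$ with $c(\alpha)=c(\alpha^{1+q})=0$), and let $K_q^\perp$ be its dual. Duals are taken with respect to the standard inner product. For a code $C\subseteq \mathbb F^n$ over a finite field $\mathbb F$ of characteristic $2$, consider the following groups of permutations of $\mathbb F^n$. The group $\mathrm{Aut}(C)$ consists of the automorphisms of the Hamming graph on $\mathbb F^n$ (words are adjacent when they differ in exactly one coordinate) that map $C$ onto itself; $\mathrm{Aut0}(C)$ is the stabilizer of the all-zero word in $\mathrm{Aut}(C)$;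 $\mathrm{AutL}_2(C)$ is the subgroup of the $\mathbb F_2$-linear transformations in $\mathrm{Aut0}(C)$. The group $\mathrm{AutM}(C)$ consists of the monomial transforms (products of a permutation matrix and an invertible diagonal matrix over $\mathbb F$) that map $C$ onto itself; $\mathrm{AutS}(C)$ consists of the compositions $\tau\circ\mu$, where $\mu$ is a monomial transform and $\tau$ is an automorphism of the field $\mathbb F$ acting simultaneously on all coordinates, that map $C$ onto itself. Then the twelve groups $\mathrm{Aut0}(C)$, $\mathrm{AutL}_2(C)$ and $\mathrm{AutS}(C)$, where $C$ is one of the four codes $M_q^\perp$, $M_q$, $K_q$, $K_q^\perp$, are all isomorphic to each other and to the general semilinear group $\Gamma\mathrm L(2,q)$ of invertible semilinear maps of $\mathbb F_q^2$. The groups $\mathrm{AutM}(M_q^\perp)$ and $\mathrm{AutM}(M_q)$ are isomorphic to $\mathrm{GL}(2,q)$. -/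

import Mathlib

open Polynomial

/-! ### Automorphism groups of codes -/

section Automorphisms

variable {ι : Type*} {F : Type*}

/-- The Hamming graph on the words `ι → F`: two words are adjacent when they are at Hamming
distance one. -/
def hammingGraph (ι F : Type*) [Fintype ι] [DecidableEq F] : SimpleGraph (ι → F) where
  Adj x y := hammingDist x y = 1
  symm := ⟨fun x y h => by rw [hammingDist_comm]; exact h⟩
  loopless := ⟨fun x h => by simp at h⟩

/-- The permutations of a set `V` that map the subset `C` onto itself. -/
def setwiseStabilizer {V : Type*} (C : Set V) : Subgroup (Equiv.Perm V) where
  carrier := {f | f '' C = C}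
  one_mem' := by simp
  mul_mem' := by
    intro f g hf hg
    simp only [Set.mem_ofPred_eq] at hf hg ⊢
    rw [Equiv.Perm.coe_mul, Set.image_comp, hg, hf]
  inv_mem' := by
    intro f hf
    simp only [Set.mem_ofPred_eq] at hf ⊢
    conv_lhs => rw [← hf]
    rw [← Set.image_comp]
    simp

/-- The automorphism group of a graph, as a group of permutations of its vertices. -/
def graphAut {V : Type*} (G : SimpleGraph V) : Subgroup (Equiv.Perm V) where
  carrier := {f | ∀ x y, G.Adj (f x) (f y) ↔ G.Adj x y}
  one_mem' := by simp
  mul_mem' := by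
    intro f g hf hg x y
    rw [Equiv.Perm.mul_apply, Equiv.Perm.mul_apply, hf, hg]
  inv_mem' := by
    intro f hf x y
    rw [← hf (f⁻¹ x) (f⁻¹ y)]
    simp

/-- `Aut(C)`: the stabilizer of `C` in the automorphism group of the Hamming graph. -/
def codeAut [Fintype ι] [DecidableEq F] (C : Set (ι → F)) : Subgroup (Equiv.Perm (ι → F)) :=
  graphAut (hammingGraph ι F) ⊓ setwiseStabilizer C

/-- `Aut0(C)`: the stabilizer of the all-zero word in `Aut(C)`. -/
def codeAut0 [Fintype ι] [DecidableEq F] [Zero F] (C : Set (ι → F)) :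
    Subgroup (Equiv.Perm (ι → F)) where
  carrier := {f | f ∈ codeAut C ∧ f 0 = 0}
  one_mem' := ⟨one_mem _, rfl⟩
  mul_mem' := by
    rintro f g ⟨hf, hf0⟩ ⟨hg, hg0⟩
    exact ⟨mul_mem hf hg, by rw [Equiv.Perm.mul_apply, hg0, hf0]⟩
  inv_mem' := by
    rintro f ⟨hf, hf0⟩
    exact ⟨inv_mem hf, by rw [Equiv.Perm.inv_eq_iff_eq, hf0]⟩

/-- `AutL_k(C)`: the transformations in `Aut0(C)` that are linear over the subfield `k`. -/
def codeAutL (k : Type*) [Field k] [Field F] [Algebra k F] [Fintype ι] [DecidableEq F]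
    (C : Set (ι → F)) : Subgroup (Equiv.Perm (ι → F)) where
  carrier := {f | f ∈ codeAut0 C ∧ IsLinearMap k (f : (ι → F) → (ι → F))}
  one_mem' := ⟨one_mem _, ⟨fun _ _ => rfl, fun _ _ => rfl⟩⟩
  mul_mem' := by
    rintro f g ⟨hf, hfl⟩ ⟨hg, hgl⟩
    refine ⟨mul_mem hf hg, ⟨fun x y => ?_, fun c x => ?_⟩⟩
    · simp only [Equiv.Perm.mul_apply]; rw [hgl.map_add, hfl.map_add]
    · simp only [Equiv.Perm.mul_apply]; rw [hgl.map_smul, hfl.map_smul]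
  inv_mem' := by
    rintro f ⟨hf, hfl⟩
    refine ⟨inv_mem hf, ⟨fun x y => ?_, fun c x => ?_⟩⟩
    · rw [Equiv.Perm.inv_eq_iff_eq, hfl.map_add]; simp
    · rw [Equiv.Perm.inv_eq_iff_eq, hfl.map_smul]; simp

/-- The semilinear transforms `τ ∘ μ` of `F^ι`: `μ` is a monomial transform (a permutation `π` of
the coordinates followed by the multiplication of each coordinate `i` by a nonzero scalar `d i`)
and the field automorphism `τ` acts simultaneously on all coordinates. -/
def semilinearTransforms (ι F : Type*) [Field F] : Subgroup (Equiv.Perm (ι → F)) where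
  carrier := {f | ∃ (τ : F ≃+* F) (π : Equiv.Perm ι) (d : ι → Fˣ),
    ∀ v i, f v i = τ ((d i : F) * v (π.symm i))}
  one_mem' := ⟨RingEquiv.refl F, 1, 1, fun v i => by simp [← Equiv.Perm.inv_def]⟩
  mul_mem' := by
    rintro f g ⟨τ, π, d, hf⟩ ⟨τ', π', d', hg⟩
    refine ⟨τ'.trans τ, π'.trans π,
      fun i => Units.map (τ'.symm : F →* F) (d i) * d' (π.symm i), fun v i => ?_⟩
    simp [hf, hg, mul_assoc]
  inv_mem' := by
    rintro f ⟨τ, π, d, hf⟩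
    refine ⟨τ.symm, π.symm, fun i => Units.map (τ : F →* F) (d (π i))⁻¹, fun v i => ?_⟩
    obtain ⟨w, rfl⟩ := f.surjective v
    simp [hf]

/-- The monomial transforms of `F^ι`: products of a permutation matrix by an invertible diagonal
matrix. -/
def monomialTransforms (ι F : Type*) [Field F] : Subgroup (Equiv.Perm (ι → F)) where
  carrier := {f | ∃ (π : Equiv.Perm ι) (d : ι → Fˣ), ∀ v i, f v i = (d i : F) * v (π.symm i)}
  one_mem' := ⟨1, 1, fun v i => by simp [← Equiv.Perm.inv_def]⟩
  mul_mem' := by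
    rintro f g ⟨π, d, hf⟩ ⟨π', d', hg⟩
    refine ⟨π'.trans π, fun i => d i * d' (π.symm i), fun v i => ?_⟩
    simp [hf, hg, mul_assoc]
  inv_mem' := by
    rintro f ⟨π, d, hf⟩
    refine ⟨π.symm, fun i => (d (π i))⁻¹, fun v i => ?_⟩
    obtain ⟨w, rfl⟩ := f.surjective v
    simp [hf]

/-- `AutS(C)`: the semilinear transforms that map `C` onto itself. -/
def codeAutS [Field F] (C : Set (ι → F)) : Subgroup (Equiv.Perm (ι → F)) :=
  semilinearTransforms ι F ⊓ setwiseStabilizer C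

/-- `AutM(C)`: the monomial transforms that map `C` onto itself. -/
def codeAutM [Field F] (C : Set (ι → F)) : Subgroup (Equiv.Perm (ι → F)) :=
  monomialTransforms ι F ⊓ setwiseStabilizer C

end Automorphisms

/-- The general semilinear group `ΓL(n, F)` of all invertible semilinear maps of `F^n`. -/
def generalSemilinearGroup (n : ℕ) (F : Type*) [Field F] :
    Subgroup (Equiv.Perm (Fin n → F)) where
  carrier := {f | (∀ x y, f (x + y) = f x + f y) ∧
    ∃ τ : F ≃+* F, ∀ (c : F) x, f (c • x) = τ c • f x}
  one_mem' := ⟨fun _ _ => rfl, RingEquiv.refl F, fun _ _ => rfl⟩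
  mul_mem' := by
    rintro f g ⟨hf, τ, hτ⟩ ⟨hg, τ', hτ'⟩
    refine ⟨fun x y => ?_, τ'.trans τ, fun c x => ?_⟩
    · simp only [Equiv.Perm.mul_apply]; rw [hg, hf]
    · simp only [Equiv.Perm.mul_apply]; rw [hτ', hτ]; rfl
  inv_mem' := by
    rintro f ⟨hf, τ, hτ⟩
    refine ⟨fun x y => ?_, τ.symm, fun c x => ?_⟩
    · rw [Equiv.Perm.inv_eq_iff_eq, hf]; simp
    · rw [Equiv.Perm.inv_eq_iff_eq, hτ]; simp

/-! ### The codes -/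

/-- The dual of a linear code with respect to the standard inner product. -/
def dualCode {ι F : Type*} [Fintype ι] [Field F] (C : Submodule F (ι → F)) :
    Submodule F (ι → F) where
  carrier := {w | ∀ c ∈ C, dotProduct w c = 0}
  zero_mem' := fun c _ => by simp
  add_mem' := fun {a b} ha hb c hc => by rw [add_dotProduct, ha c hc, hb c hc, add_zero]
  smul_mem' := fun r a ha c hc => by rw [smul_dotProduct, ha c hc, smul_zero]

/-- The polynomial `c₀ + c₁ X + ⋯ + cₙ₋₁ Xⁿ⁻¹` of a word of length `n` over `F`, with its
coefficients read in the extension `E` of `F`. -/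
noncomputable def wordPoly {n : ℕ} {F : Type*} (E : Type*) [Field F] [Field E] [Algebra F E]
    (c : Fin n → F) : E[X] :=
  ∑ i, C (algebraMap F E (c i)) * X ^ (i : ℕ)

theorem wordPoly_add {n : ℕ} {F E : Type*} [Field F] [Field E] [Algebra F E] (a b : Fin n → F) :
    wordPoly E (a + b) = wordPoly E a + wordPoly E b := by
  simp [wordPoly, add_mul, Finset.sum_add_distrib]

theorem wordPoly_smul {n : ℕ} {F E : Type*} [Field F] [Field E] [Algebra F E] (r : F)
    (a : Fin n → F) : wordPoly E (r • a) = C (algebraMap F E r) * wordPoly E a := by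
  simp [wordPoly, Finset.mul_sum, mul_assoc]

/-- The cyclic code of length `n` over `F` with check polynomial `h`: the words `c` with
`c(x) h(x) = 0` modulo `xⁿ - 1`. Here `h` is given by its factorization over an extension `E`
of `F`. -/
def cyclicCodeOfCheck (n : ℕ) (F : Type*) {E : Type*} [Field F] [Field E] [Algebra F E]
    (h : E[X]) : Submodule F (Fin n → F) where
  carrier := {c | (X ^ n - 1 : E[X]) ∣ wordPoly E c * h}
  zero_mem' := by simp [wordPoly]
  add_mem' := fun {a b} ha hb => by
    simp only [Set.mem_ofPred_eq] at ha hb ⊢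
    rw [wordPoly_add, add_mul]; exact dvd_add ha hb
  smul_mem' := fun r a ha => by
    simp only [Set.mem_ofPred_eq] at ha ⊢
    rw [wordPoly_smul, mul_assoc]; exact ha.mul_left _

/-- The cyclic code of length `n` over `F` with prescribed zeros: the words `c` whose polynomial
`c(x)` vanishes at all points of the set `Z` of elements of the extension `E`. -/
def cyclicCodeOfZeros (n : ℕ) (F : Type*) {E : Type*} [Field F] [Field E] [Algebra F E]
    (Z : Set E) : Submodule F (Fin n → F) where
  carrier := {c | ∀ z ∈ Z, (wordPoly E c).eval z = 0}
  zero_mem' := by simp [wordPoly]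
  add_mem' := fun {a b} ha hb z hz => by
    rw [wordPoly_add, eval_add, ha z hz, hb z hz, add_zero]
  smul_mem' := fun r a ha z hz => by
    rw [wordPoly_smul, eval_mul, ha z hz, mul_zero]

/-- The code `M_q^⊥` over `F = F_q`: the cyclic code of length `q + 1` with check polynomial
`(x - 1) (x - ζ) (x - ζ^q)`, where `ζ = α^(q-1)`. -/
noncomputable def codeMdual (q : ℕ) (F : Type*) {E : Type*} [Field F] [Field E] [Algebra F E]
    (α : E) : Submodule F (Fin (q + 1) → F) :=
  cyclicCodeOfCheck (q + 1) F
    ((X - 1) * (X - C (α ^ (q - 1))) * (X - C ((α ^ (q - 1)) ^ q)) : E[X])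

/-- The code `M_q`, the dual of `M_q^⊥`. -/
noncomputable def codeM (q : ℕ) (F : Type*) {E : Type*} [Field F] [Field E] [Algebra F E]
    (α : E) : Submodule F (Fin (q + 1) → F) :=
  dualCode (codeMdual q F α)

/-- The Kasami code `K_q`: the binary cyclic code of length `q² - 1` with the two zeros `α` and
`α^(1+q)`. -/
def codeK (q : ℕ) {E : Type*} [Field E] [Algebra (ZMod 2) E] (α : E) :
    Submodule (ZMod 2) (Fin (q ^ 2 - 1) → ZMod 2) :=
  cyclicCodeOfZeros (q ^ 2 - 1) (ZMod 2) {α, α ^ (1 + q)}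

/-- The code `K_q^⊥`, the dual of the Kasami code. -/
def codeKdual (q : ℕ) {E : Type*} [Field E] [Algebra (ZMod 2) E] (α : E) :
    Submodule (ZMod 2) (Fin (q ^ 2 - 1) → ZMod 2) :=
  dualCode (codeK q α)

/-!
Let `u i` be representatives of the `q + 1` points of the projective line over `F`. In coordinates
with respect to an `F`-basis of `E`, the elements of norm one form such a system, and the squares
and norms of the elements of `E` span the binary quadratic forms (`sum_sq_norm_eq_zero_iff`). Hence
`M_q^⊥` is the conic code of the words `(Q (u i))ᵢ`, where `Q` runs through the quadratic forms
(`cyclicCode_eq_conicCode`), and `K_q` consists of the sets of nonzero vectors of `F²` on which all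
quadratic forms sum to zero (`codeK_eq_kasamiModel`). A semilinear map `g` with accompanying
automorphism `τ` acts on the words, seen as homogeneous functions `φ` of degree two on `F²`, by
`φ ↦ τ ∘ φ ∘ g⁻¹`, and this preserves the quadratic forms.

* Semilinear automorphisms of the conic code. Such an automorphism sends the products of linear
  forms `ℓᵢ²`, `ℓᵢ ℓⱼ`, `ℓⱼ²`, where `ℓᵢ` vanishes at `u i`, to multiples of the analogous products
  for the images of the two points. The three factors are related by `ℓᵢ² ℓⱼ² = (ℓᵢ ℓⱼ)²`, so a
  semilinear map of `F²` induces the same transform; see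
  `IsProjectiveFrame.exists_action_eqOn_conicCode`. The linear maps induce the monomial transforms.
* Arbitrary Hamming automorphisms. An automorphism fixing zero acts by a permutation `π` of the
  coordinates and permutations `σ i` of the alphabet (`exists_perm_of_graphAut`). The conic code is
  MDS, and so is its dual. In an MDS code of dimension `k ≥ 2`, the words vanishing on `k - 2`
  coordinates force the `σ i` to be additive, and the words of minimum weight force them to be
  multiples of one multiplicative map if the ratios of two coordinates of such words take all
  nonzero values. This property holds for the conic code if `q ≥ 4`, and it passes to the dual; see
  `IsMDS.codeAut0_le_codeAutS`. For `q = 2` the alphabet is binary and there is nothing to prove.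
* Duality. The contragredient of a semilinear transform is its conjugate by the coordinatewise
  inversion `v ↦ v⁻¹`, which therefore exchanges the groups of a code and of its dual.
* The Kasami code. The words of weight three in `K_q` show that an automorphism permutes the
  lines through the origin of `F²`; it therefore induces a Hamming automorphism of `M_q`, and is
  semilinear by the above; see `PreservesRelations.exists_semilinearPair`.
-/

/-! ### Automorphisms of the Hamming graph -/

section HammingAut

variable {ι F : Type*} [Fintype ι] [DecidableEq F]

theorem hammingDist_le_of_graphAut {f : Equiv.Perm (ι → F)} (hf : f ∈ graphAut (hammingGraph ι F)) :
    ∀ (n : ℕ) (x y : ι → F), hammingDist x y = n → hammingDist (f x) (f y) ≤ n := by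
  classical
  intro n
  induction n with
  | zero =>
    intro x y h
    rw [hammingDist_eq_zero] at h
    simp [h]
  | succ n ih =>
    intro x y h
    obtain ⟨i, hi⟩ : ∃ i, x i ≠ y i := by
      by_contra hc
      push Not at hc
      rw [funext hc] at h
      simp at h
    -- one step of a geodesic from `x` to `y`: correct the coordinate `i`
    set z := Function.update x i (y i) with hz
    have h1 : hammingDist x z = 1 := by
      rw [hammingDist, Finset.card_eq_one]
      refine ⟨i, ?_⟩
      ext j
      by_cases hj : j = i
      · subst hj; simp [hz, hi]
      · simp [hz, hj]
    have h2 : hammingDist z y = n := by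
      have : (Finset.univ.filter fun j => z j ≠ y j) =
          (Finset.univ.filter fun j => x j ≠ y j).erase i := by
        ext j
        by_cases hj : j = i
        · subst hj; simp [hz]
        · simp [hz, hj]
      rw [hammingDist, this, Finset.card_erase_of_mem (by simp [hi])]
      rw [hammingDist] at h
      omega
    have h3 : hammingDist (f x) (f z) = 1 := (hf x z).2 h1
    have := hammingDist_triangle (f x) (f z) (f y)
    have := ih z y h2
    omega

theorem hammingDist_graphAut {f : Equiv.Perm (ι → F)} (hf : f ∈ graphAut (hammingGraph ι F))
    (x y : ι → F) : hammingDist (f x) (f y) = hammingDist x y := by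
  refine le_antisymm (hammingDist_le_of_graphAut hf _ x y rfl) ?_
  have := hammingDist_le_of_graphAut (inv_mem hf) _ (f x) (f y) rfl
  simpa using this

theorem exists_single_of_hammingNorm_eq_one [DecidableEq ι] [Zero F] {x : ι → F}
    (h : hammingNorm x = 1) : ∃ k μ, μ ≠ 0 ∧ x = Pi.single k μ := by
  obtain ⟨k, hk⟩ := Finset.card_eq_one.1 h
  have hx : ∀ j, x j ≠ 0 ↔ j = k := fun j => by
    have := Finset.ext_iff.1 hk j
    simpa using this
  refine ⟨k, x k, (hx k).2 rfl, ?_⟩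
  ext j
  by_cases hj : j = k
  · subst hj; simp
  · rw [Pi.single_eq_of_ne hj]
    by_contra h0
    exact hj ((hx j).1 h0)

theorem hammingNorm_single [DecidableEq ι] [Zero F] (k : ι) {μ : F} (hμ : μ ≠ 0) :
    hammingNorm (Pi.single k μ : ι → F) = 1 := by
  rw [hammingNorm, Finset.card_eq_one]
  refine ⟨k, ?_⟩
  ext j
  by_cases hj : j = k
  · subst hj; simp [hμ]
  · simp [hj]

theorem hammingDist_single_single [DecidableEq ι] [Zero F] (k : ι) (μ ν : F) :
    hammingDist (Pi.single k μ : ι → F) (Pi.single k ν) ≤ 1 := by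
  rw [hammingDist, Finset.card_le_one]
  have : ∀ j, (Pi.single k μ : ι → F) j ≠ (Pi.single k ν : ι → F) j → j = k := by
    intro j h
    by_contra hj
    simp [hj] at h
  intro a ha b hb
  rw [this a (by simpa using ha), this b (by simpa using hb)]

theorem eq_of_hammingDist_single_le_one [DecidableEq ι] [Zero F] {k l : ι} {μ ν : F}
    (hμ : μ ≠ 0) (hν : ν ≠ 0)
    (h : hammingDist (Pi.single k μ : ι → F) (Pi.single l ν) ≤ 1) : k = l := by
  by_contra hkl
  rw [hammingDist, Finset.card_le_one] at h
  exact hkl (h k (by simp [hkl, hμ]) l (by simp [Ne.symm hkl, hν.symm]))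

/-- Among the words supported on the coordinate `k`, the one closest to `w` agrees with `w`
at `k`. -/
theorem hammingDist_single_lt [DecidableEq ι] [Zero F] (w : ι → F) (k : ι) {μ : F} (h : μ ≠ w k) :
    hammingDist w (Pi.single k (w k)) < hammingDist w (Pi.single k μ) := by
  refine Finset.card_lt_card ((Finset.ssubset_iff_of_subset ?_).2 ⟨k, ?_, ?_⟩)
  · intro j hj
    by_cases hjk : j = k
    · subst hjk; simp at hj
    · simpa [hjk] using hj
  · simpa using h.symm
  · simp

/-- An automorphism of the Hamming graph that fixes the zero word permutes the coordinates and
acts on every coordinate by a permutation of the alphabet fixing zero. -/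
theorem exists_perm_of_graphAut [Finite F] [Zero F] [Nontrivial F] {f : Equiv.Perm (ι → F)}
    (hf : f ∈ graphAut (hammingGraph ι F)) (h0 : f 0 = 0) :
    ∃ (π : Equiv.Perm ι) (σ : ι → Equiv.Perm F), (∀ i, σ i 0 = 0) ∧
      ∀ v i, f v (π i) = σ i (v i) := by
  classical
  have hd := hammingDist_graphAut hf
  have hs : ∀ i (c : F), c ≠ 0 → ∃ k μ, μ ≠ 0 ∧ f (Pi.single i c) = Pi.single k μ := by
    intro i c hc
    apply exists_single_of_hammingNorm_eq_one
    rw [← hammingDist_zero_right, ← h0, hd, hammingDist_zero_right, hammingNorm_single i hc]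
  obtain ⟨one, hone⟩ := exists_ne (0 : F)
  choose π μ hμ hπ using fun i => hs i one hone
  have hπ' : ∀ i c, f (Pi.single i c) = Pi.single (π i) (f (Pi.single i c) (π i)) := by
    intro i c
    by_cases hc : c = 0
    · subst hc; simp [h0]
    · obtain ⟨k, ν, hν, hk⟩ := hs i c hc
      have : k = π i := by
        apply eq_of_hammingDist_single_le_one hν (hμ i)
        rw [← hk, ← hπ, hd]
        exact hammingDist_single_single _ _ _
      subst this
      simp [hk]
  have hinj : Function.Injective π := by
    intro i j hij
    apply eq_of_hammingDist_single_le_one hone hone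
    rw [← hd, hπ, hπ, hij]
    exact hammingDist_single_single _ _ _
  have hσ : ∀ i, Function.Injective fun c => f (Pi.single i c) (π i) := by
    intro i c c' h
    have h' : f (Pi.single i c) = f (Pi.single i c') := by
      rw [hπ' i c, hπ' i c']
      exact congrArg _ h
    exact Pi.single_injective i (f.injective h')
  refine ⟨Equiv.ofBijective π (Finite.injective_iff_bijective.1 hinj),
    fun i => Equiv.ofBijective _ (Finite.injective_iff_bijective.1 (hσ i)), fun i => ?_,
    fun v i => ?_⟩
  · simp [h0]
  · obtain ⟨c, hc⟩ := (Finite.injective_iff_bijective.1 (hσ i)).2 (f v (π i))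
    simp only [Equiv.ofBijective_apply]
    by_contra hne
    have h1 := hammingDist_single_lt (f v) (π i) (Ne.symm hne)
    rw [← hπ', hd, ← hc] at h1
    simp only at h1
    rw [← hπ', hd] at h1
    by_cases hcv : c = v i
    · rw [hcv] at h1
      exact lt_irrefl _ h1
    · exact lt_asymm h1 (hammingDist_single_lt v i hcv)

/-- Conversely, coordinatewise permutations of the alphabet combined with a permutation of the
coordinates are automorphisms of the Hamming graph. -/
theorem mem_graphAut_of_perm {f : Equiv.Perm (ι → F)} (π : Equiv.Perm ι) (σ : ι → Equiv.Perm F)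
    (h : ∀ v i, f v (π i) = σ i (v i)) : f ∈ graphAut (hammingGraph ι F) := by
  intro x y
  have : hammingDist (f x) (f y) = hammingDist x y := by
    rw [hammingDist, hammingDist]
    refine (Finset.card_bij (fun i _ => π i) ?_ ?_ ?_).symm
    · intro i hi
      simpa [h] using hi
    · intro i _ j _ hij
      exact π.injective hij
    · intro k hk
      obtain ⟨i, rfl⟩ := π.surjective k
      exact ⟨i, by simpa [h] using hk, rfl⟩
  change hammingDist (f x) (f y) = 1 ↔ hammingDist x y = 1
  rw [this]

end HammingAut

/-! ### Semilinear transforms, binary codes and duality -/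

section Semilinear

variable {ι F : Type*} [Field F]

theorem mem_setwiseStabilizer_of_forall {V : Type*} {C : Set V} {f : Equiv.Perm V}
    (h : ∀ v ∈ C, f v ∈ C) (h' : ∀ v ∈ C, f⁻¹ v ∈ C) : f ∈ setwiseStabilizer C := by
  change f '' C = C
  refine Set.Subset.antisymm (Set.image_subset_iff.2 h) fun v hv => ⟨f⁻¹ v, h' v hv, by simp⟩

theorem map_mem_of_mem_setwiseStabilizer {V : Type*} {C : Set V} {f : Equiv.Perm V}
    (h : f ∈ setwiseStabilizer C) {v : V} (hv : v ∈ C) : f v ∈ C := by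
  have h' : f '' C = C := h
  rw [← h']
  exact ⟨v, hv, rfl⟩

theorem monomialTransforms_le_semilinearTransforms :
    monomialTransforms ι F ≤ semilinearTransforms ι F := by
  rintro f ⟨π, d, h⟩
  exact ⟨RingEquiv.refl F, π, d, fun v i => by simp [h]⟩

theorem codeAutS_le_codeAutL [Fintype ι] [DecidableEq F] [Algebra (ZMod 2) F]
    (C : Set (ι → F)) : codeAutS C ≤ codeAutL (ZMod 2) C := by
  rintro f ⟨⟨τ, π, d, h⟩, hC⟩
  have hadd : ∀ x y, f (x + y) = f x + f y := fun x y => by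
    ext i
    simp [h, mul_add]
  refine ⟨⟨⟨?_, hC⟩, ?_⟩, hadd, fun c x => ?_⟩
  · refine mem_graphAut_of_perm π
      (fun i => (Equiv.mulLeft₀ (d (π i) : F) (d (π i)).ne_zero).trans τ.toEquiv) fun v i => ?_
    simp [h]
  · ext i
    simp [h]
  · exact map_smul ((AddMonoidHom.mk' f hadd).toZModLinearMap 2) c x

theorem codeAutL_le_codeAut0 (k : Type*) [Field k] [Algebra k F] [Fintype ι] [DecidableEq F]
    (C : Set (ι → F)) : codeAutL k C ≤ codeAut0 C := fun _ h => h.1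

/-- Over an alphabet with two elements, a permutation of the alphabet fixing zero is trivial, so
that all automorphisms fixing the zero word are coordinate permutations. -/
theorem codeAut0_le_codeAutS_of_binary [Fintype ι] [DecidableEq F] (hF : ∀ x : F, x = 0 ∨ x = 1)
    (C : Set (ι → F)) : codeAut0 C ≤ codeAutS C := by
  rintro f ⟨⟨hf, hC⟩, h0⟩
  have : Finite F := Set.finite_univ_iff.1
    ((Set.toFinite {0, 1}).subset fun x _ => by simpa using hF x)
  obtain ⟨π, σ, hσ, h⟩ := exists_perm_of_graphAut hf h0
  refine ⟨⟨RingEquiv.refl F, π, 1, fun v i => ?_⟩, hC⟩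
  have hid : ∀ i x, σ i x = x := by
    intro i x
    rcases hF x with rfl | rfl
    · exact hσ i
    · rcases hF (σ i 1) with h1 | h1
      · rw [← hσ i] at h1
        exact absurd ((σ i).injective h1) one_ne_zero
      · exact h1
  have := h v (π.symm i)
  rw [Equiv.apply_symm_apply, hid] at this
  simp [this]

/-- The permutation of the words that inverts every coordinate, with the convention `0⁻¹ = 0`. -/
def coordInv (ι F : Type*) [Field F] : Equiv.Perm (ι → F) :=
  ⟨fun v => v⁻¹, fun v => v⁻¹, fun v => inv_inv v, fun v => inv_inv v⟩

@[simp]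
theorem coordInv_apply (v : ι → F) : coordInv ι F v = v⁻¹ := rfl

@[simp]
theorem coordInv_inv : (coordInv ι F)⁻¹ = coordInv ι F := rfl

theorem mem_dualCode [Fintype ι] {C : Submodule F (ι → F)} {w : ι → F} :
    w ∈ dualCode C ↔ ∀ c ∈ C, dotProduct w c = 0 := Iff.rfl

theorem dualCode_dualCode [Fintype ι] (C : Submodule F (ι → F)) : dualCode (dualCode C) = C := by
  classical
  let B : LinearMap.BilinForm F (ι → F) := dotProductBilin F F
  have hB : ∀ x y, B x y = dotProduct x y := fun _ _ => rfl
  have hsymm : B.IsRefl := fun x y h => by rw [hB] at h ⊢; rw [dotProduct_comm]; exact h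
  have hnd : B.Nondegenerate := by
    refine ⟨fun x h => dotProduct_eq_zero x h, fun x h => dotProduct_eq_zero x fun y => ?_⟩
    rw [dotProduct_comm]; exact h y
  have hdual : ∀ D : Submodule F (ι → F), dualCode D = B.orthogonal D := by
    intro D
    ext w
    rw [LinearMap.BilinForm.mem_orthogonal_iff, mem_dualCode]
    refine forall₂_congr fun c _ => ?_
    rw [hB, dotProduct_comm]
  rw [hdual, hdual, LinearMap.BilinForm.orthogonal_orthogonal hnd hsymm]

/-- Conjugation by the coordinatewise inversion turns a semilinear transform `τ ∘ π ∘ diag d` into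
its contragredient `τ ∘ π ∘ diag d⁻¹`. -/
theorem coordInv_conj_apply {f : Equiv.Perm (ι → F)} {τ : F ≃+* F} {π : Equiv.Perm ι}
    {d : ι → Fˣ} (h : ∀ v i, f v i = τ ((d i : F) * v (π.symm i))) (v : ι → F) (i : ι) :
    (coordInv ι F * f * (coordInv ι F)⁻¹) v i = τ (((d i)⁻¹ : Fˣ) * v (π.symm i)) := by
  simp [h, mul_comm]

theorem coordInv_conj_mem_stabilizer [Fintype ι] {C : Submodule F (ι → F)}
    {f : Equiv.Perm (ι → F)} (hf : f ∈ semilinearTransforms ι F)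
    (hC : f ∈ setwiseStabilizer (C : Set (ι → F))) :
    coordInv ι F * f * (coordInv ι F)⁻¹ ∈ setwiseStabilizer (dualCode C : Set (ι → F)) := by
  have key : ∀ g : Equiv.Perm (ι → F), g ∈ semilinearTransforms ι F →
      g⁻¹ ∈ setwiseStabilizer (C : Set (ι → F)) →
      ∀ w ∈ dualCode C, (coordInv ι F * g * (coordInv ι F)⁻¹) w ∈ dualCode C := by
    rintro g ⟨τ, π, d, h⟩ hg w hw c hc
    have h1 := hw _ (map_mem_of_mem_setwiseStabilizer hg hc)
    set c' := g⁻¹ c with hc'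
    have h2 : c = g c' := by simp [hc']
    have h3 : dotProduct ((coordInv ι F * g * (coordInv ι F)⁻¹) w) c = τ (dotProduct w c') := by
      rw [h2, dotProduct, dotProduct, map_sum]
      refine Fintype.sum_equiv π.symm _ _ fun i => ?_
      rw [coordInv_conj_apply h, h, ← map_mul]
      congr 1
      rw [mul_mul_mul_comm, Units.inv_mul, one_mul]
    rw [h3, h1, map_zero]
  refine mem_setwiseStabilizer_of_forall (key f hf (inv_mem hC)) ?_
  have h1 : (coordInv ι F * f * (coordInv ι F)⁻¹)⁻¹ = coordInv ι F * f⁻¹ * (coordInv ι F)⁻¹ := by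
    group
  rw [h1]
  exact key f⁻¹ (inv_mem hf) (by rwa [inv_inv])

theorem coordInv_conj_mem_codeAutS [Fintype ι] {C : Submodule F (ι → F)}
    {f : Equiv.Perm (ι → F)} (hf : f ∈ codeAutS (C : Set (ι → F))) :
    coordInv ι F * f * (coordInv ι F)⁻¹ ∈ codeAutS (dualCode C : Set (ι → F)) := by
  refine ⟨?_, coordInv_conj_mem_stabilizer hf.1 hf.2⟩
  obtain ⟨τ, π, d, h⟩ := hf.1
  exact ⟨τ, π, d⁻¹, coordInv_conj_apply h⟩

theorem coordInv_conj_mem_codeAutM [Fintype ι] {C : Submodule F (ι → F)}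
    {f : Equiv.Perm (ι → F)} (hf : f ∈ codeAutM (C : Set (ι → F))) :
    coordInv ι F * f * (coordInv ι F)⁻¹ ∈ codeAutM (dualCode C : Set (ι → F)) := by
  refine ⟨?_, coordInv_conj_mem_stabilizer (monomialTransforms_le_semilinearTransforms hf.1) hf.2⟩
  obtain ⟨π, d, h⟩ := hf.1
  refine ⟨π, d⁻¹, fun v i => ?_⟩
  exact coordInv_conj_apply (τ := RingEquiv.refl F) h v i

theorem coordInv_conj_conj (f : Equiv.Perm (ι → F)) :
    coordInv ι F * (coordInv ι F * f * (coordInv ι F)⁻¹) * (coordInv ι F)⁻¹ = f := by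
  ext v i
  simp

theorem nonempty_mulEquiv_of_coordInv {G H : Subgroup (Equiv.Perm (ι → F))}
    (hGH : ∀ f ∈ G, coordInv ι F * f * (coordInv ι F)⁻¹ ∈ H)
    (hHG : ∀ f ∈ H, coordInv ι F * f * (coordInv ι F)⁻¹ ∈ G) : Nonempty (G ≃* H) :=
  ⟨{ toFun := fun f => ⟨_, hGH f f.2⟩
     invFun := fun f => ⟨_, hHG f f.2⟩
     left_inv := fun f => Subtype.ext (coordInv_conj_conj _)
     right_inv := fun f => Subtype.ext (coordInv_conj_conj _)
     map_mul' := fun f g => Subtype.ext (by ext v i; simp) }⟩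

theorem nonempty_codeAutS_mulEquiv_dualCode [Fintype ι] (C : Submodule F (ι → F)) :
    Nonempty (codeAutS (C : Set (ι → F)) ≃* codeAutS (dualCode C : Set (ι → F))) := by
  refine nonempty_mulEquiv_of_coordInv (fun f => coordInv_conj_mem_codeAutS) fun f hf => ?_
  have := coordInv_conj_mem_codeAutS hf
  rwa [dualCode_dualCode] at this

theorem nonempty_codeAutM_mulEquiv_dualCode [Fintype ι] (C : Submodule F (ι → F)) :
    Nonempty (codeAutM (C : Set (ι → F)) ≃* codeAutM (dualCode C : Set (ι → F))) := by
  refine nonempty_mulEquiv_of_coordInv (fun f => coordInv_conj_mem_codeAutM) fun f hf => ?_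
  have := coordInv_conj_mem_codeAutM hf
  rwa [dualCode_dualCode] at this

theorem codeAut_groups_eq [Fintype ι] [DecidableEq F] [Algebra (ZMod 2) F] {C : Set (ι → F)}
    (h : codeAut0 C ≤ codeAutS C) : codeAut0 C = codeAutS C ∧ codeAutL (ZMod 2) C = codeAutS C :=
  ⟨le_antisymm h ((codeAutS_le_codeAutL C).trans (codeAutL_le_codeAut0 _ C)),
    le_antisymm ((codeAutL_le_codeAut0 _ C).trans h) (codeAutS_le_codeAutL C)⟩

end Semilinear

/-! ### MDS codes -/

section MDS

variable {ι F : Type*} [Field F]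

/-- A linear code is MDS of dimension `k` when every set of `k` coordinates is an information
set: a codeword is determined by its values on the set, which can be prescribed arbitrarily. -/
structure IsMDS (k : ℕ) (C : Submodule F (ι → F)) : Prop where
  eq_zero : ∀ K : Finset ι, K.card = k → ∀ c ∈ C, (∀ i ∈ K, c i = 0) → c = 0
  exists_eq : ∀ K : Finset ι, K.card = k → ∀ x : ι → F, ∃ c ∈ C, ∀ i ∈ K, c i = x i

/-- For any two coordinates `i`, `j`, the quotients `c i / c j` of the minimum weight words `c` of
an MDS code of dimension `k` take all nonzero values. -/
def HasAllRatios (k : ℕ) (C : Submodule F (ι → F)) : Prop :=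
  ∀ i j, i ≠ j → ∀ r : F, r ≠ 0 → ∃ c ∈ C, ∃ T : Finset ι, T.card + 1 = k ∧ i ∉ T ∧ j ∉ T ∧
    (∀ l ∈ T, c l = 0) ∧ c j = 1 ∧ c i = r

theorem IsMDS.eq_of_eqOn {k : ℕ} {C : Submodule F (ι → F)} (h : IsMDS k C) {K : Finset ι}
    (hK : K.card = k) {c c' : ι → F} (hc : c ∈ C) (hc' : c' ∈ C) (heq : ∀ i ∈ K, c i = c' i) :
    c = c' := by
  rw [← sub_eq_zero]
  exact h.eq_zero K hK _ (sub_mem hc hc') fun i hi => by simp [heq i hi]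

variable [Fintype ι]

theorem IsMDS.dualCode {k l : ℕ} {C : Submodule F (ι → F)} (h : IsMDS k C)
    (hkl : k + l = Fintype.card ι) : IsMDS l (dualCode C) := by
  classical
  -- `e K i` is the codeword equal to the indicator of `i` on the complement of `K`
  have he : ∀ K : Finset ι, K.card = l → ∀ i, ∃ c ∈ C,
      ∀ j ∉ K, c j = Pi.single (M := fun _ => F) i 1 j := by
    intro K hK i
    obtain ⟨c, hc, hcK⟩ := h.exists_eq Kᶜ (by rw [Finset.card_compl]; omega) (Pi.single i 1)
    exact ⟨c, hc, fun j hj => hcK j (by simpa using hj)⟩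
  constructor
  · intro K hK w hw hwK
    ext i
    by_cases hi : i ∈ K
    · exact hwK i hi
    · obtain ⟨c, hc, hcK⟩ := he K hK i
      have h1 := hw c hc
      rw [dotProduct, Finset.sum_eq_single i] at h1
      · rwa [hcK i hi, Pi.single_eq_same, mul_one] at h1
      · intro j _ hj
        by_cases hjK : j ∈ K
        · rw [hwK j hjK, zero_mul]
        · rw [hcK j hjK, Pi.single_eq_of_ne hj, mul_zero]
      · simp
  · intro K hK x
    choose e heC heK using he K hK
    refine ⟨fun i => if i ∈ K then x i else -∑ j ∈ K, x j * e i j, ?_, fun i hi => by simp [hi]⟩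
    intro c hc
    have hce : c = ∑ i ∈ Kᶜ, c i • e i := by
      refine h.eq_of_eqOn (K := Kᶜ) (by rw [Finset.card_compl]; omega) hc
        (sum_mem fun i _ => Submodule.smul_mem _ _ (heC i)) fun j hj => ?_
      have hj' : j ∉ K := by simpa using hj
      rw [Finset.sum_apply, Finset.sum_eq_single j]
      · simp [heK j j hj']
      · intro i _ hij
        simp [heK i j hj', hij.symm]
      · exact fun hn => absurd hj hn
    rw [dotProduct, ← Finset.sum_add_sum_compl K]
    have h1 : ∑ i ∈ K, (if i ∈ K then x i else -∑ j ∈ K, x j * e i j) * c i =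
        ∑ i ∈ Kᶜ, c i * ∑ j ∈ K, x j * e i j := by
      simp_rw [Finset.mul_sum]
      rw [Finset.sum_comm]
      refine Finset.sum_congr rfl fun j hj => ?_
      rw [if_pos hj]
      conv_lhs => rw [hce]
      rw [Finset.sum_apply, Finset.mul_sum]
      refine Finset.sum_congr rfl fun i _ => ?_
      simp only [Pi.smul_apply, smul_eq_mul]
      ring
    have h2 : ∑ i ∈ Kᶜ, (if i ∈ K then x i else -∑ j ∈ K, x j * e i j) * c i =
        -∑ i ∈ Kᶜ, c i * ∑ j ∈ K, x j * e i j := by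
      rw [← Finset.sum_neg_distrib]
      refine Finset.sum_congr rfl fun i hi => ?_
      rw [if_neg (by simpa using hi)]
      ring
    rw [h1, h2, add_neg_cancel]

/-- If `c ∈ C` vanishes on `T`, then a word of the dual vanishing on the complement of
`T ∪ {i, j}` is orthogonal to `c` on the two coordinates `i` and `j` alone. -/
theorem HasAllRatios.dualCode {k l : ℕ} {C : Submodule F (ι → F)} (h : IsMDS k C)
    (hr : HasAllRatios k C) (hkl : k + l = Fintype.card ι) : HasAllRatios l (dualCode C) := by
  classical
  intro i j hij r hr0
  obtain ⟨c, hc, T, hT, hi, hj, hcT, hcj, hci⟩ := hr i j hij (-r⁻¹) (by simpa using hr0)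
  have hcard : (insert i (insert j T)).card = k + 1 := by
    rw [Finset.card_insert_of_notMem (by simp [hij, hi]), Finset.card_insert_of_notMem hj]
    omega
  have hle := Finset.card_le_univ (insert i (insert j T))
  have hS : (insert i (insert j T))ᶜ.card + 1 = l := by
    rw [Finset.card_compl]
    omega
  obtain ⟨w, hw, hwS⟩ := (h.dualCode hkl).exists_eq (insert j (insert i (insert j T))ᶜ)
    (by rw [Finset.card_insert_of_notMem (by simp), hS]) (Pi.single j 1)
  have hw0 : ∀ m ∈ (insert i (insert j T))ᶜ, w m = 0 := by
    intro m hm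
    rw [hwS m (by rw [Finset.mem_insert]; exact Or.inr hm), Pi.single_eq_of_ne]
    rintro rfl
    simp at hm
  have hwj : w j = 1 := by
    rw [hwS j (by simp), Pi.single_eq_same]
  refine ⟨w, hw, _, hS, by simp, by simp, hw0, hwj, ?_⟩
  have h1 := hw c hc
  rw [dotProduct, Finset.sum_eq_add i j hij] at h1
  · rw [hci, hcj, hwj] at h1
    field_simp at h1
    linear_combination -h1
  · rintro m - ⟨hmi, hmj⟩
    by_cases hm : m ∈ T
    · rw [hcT m hm, mul_zero]
    · rw [hw0 m (by simp [hmi, hmj, hm]), zero_mul]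
  · simp
  · simp

/-- A Hamming automorphism of an MDS code that fixes the zero word acts by additive permutations on
the alphabets: a two-dimensional subcode supported on three coordinates `i`, `j`, `l` and some
others expresses the coordinate `l` through the coordinates `i` and `j`. -/
theorem IsMDS.additive_of_perm {k : ℕ} {C : Submodule F (ι → F)} (h : IsMDS k C) (hk : 2 ≤ k)
    (hkn : k < Fintype.card ι) {f : Equiv.Perm (ι → F)} {π : Equiv.Perm ι}
    {σ : ι → Equiv.Perm F} (hσ : ∀ i, σ i 0 = 0) (hf : ∀ v i, f v (π i) = σ i (v i))
    (hC : ∀ c ∈ C, f c ∈ C) (l : ι) (x y : F) : σ l (x + y) = σ l x + σ l y := by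
  classical
  obtain ⟨S, hlS, hS⟩ := Finset.exists_superset_card_eq (s := {l}) (n := k + 1)
    (by simp) (by omega)
  have hlS : l ∈ S := by simpa using hlS
  obtain ⟨i, hi⟩ : (S.erase l).Nonempty := by
    rw [← Finset.card_pos, Finset.card_erase_of_mem hlS]
    omega
  have hSl : (S.erase l).card = k := by rw [Finset.card_erase_of_mem hlS]; omega
  obtain ⟨j, hj⟩ : ((S.erase l).erase i).Nonempty := by
    rw [← Finset.card_pos, Finset.card_erase_of_mem hi]
    omega
  have hji : j ≠ i := (Finset.mem_erase.1 hj).1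
  have hjl : j ≠ l := (Finset.mem_erase.1 (Finset.mem_erase.1 hj).2).1
  have hjS : j ∈ S := (Finset.mem_erase.1 (Finset.mem_erase.1 hj).2).2
  have hil : i ≠ l := (Finset.mem_erase.1 hi).1
  have hiS : i ∈ S := (Finset.mem_erase.1 hi).2
  have hw : ∀ m ∈ S, m ≠ l → ∃ c ∈ C, c l = 1 ∧ ∀ t ∈ S, t ≠ l → t ≠ m → c t = 0 := by
    intro m hm hml
    obtain ⟨c, hc, hcS⟩ := h.exists_eq (S.erase m)
      (by rw [Finset.card_erase_of_mem hm]; omega) (Pi.single l 1)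
    refine ⟨c, hc, ?_, fun t ht htl htm => ?_⟩
    · rw [hcS l (Finset.mem_erase.2 ⟨hml.symm, hlS⟩), Pi.single_eq_same]
    · rw [hcS t (Finset.mem_erase.2 ⟨htm, ht⟩), Pi.single_eq_of_ne htl]
  obtain ⟨a, ha, hal, ha0⟩ := hw i hiS hil
  obtain ⟨b, hb, hbl, hb0⟩ := hw j hjS hjl
  have hadd : f (x • a + y • b) = f (x • a) + f (y • b) := by
    have hxa := Submodule.smul_mem C x ha
    have hyb := Submodule.smul_mem C y hb
    refine h.eq_of_eqOn (K := (S.erase l).map π.toEmbedding) (by rw [Finset.card_map, hSl])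
      (hC _ (add_mem hxa hyb)) (add_mem (hC _ hxa) (hC _ hyb)) fun s hs => ?_
    obtain ⟨t, ht, rfl⟩ := Finset.mem_map.1 hs
    obtain ⟨htl, htS⟩ := Finset.mem_erase.1 ht
    simp only [Equiv.coe_toEmbedding, Pi.add_apply, hf, Pi.smul_apply, smul_eq_mul]
    by_cases hti : t = i
    · rw [hb0 t htS htl (by rw [hti]; exact hji.symm), mul_zero, hσ, add_zero, add_zero]
    · rw [ha0 t htS htl hti, mul_zero, hσ, zero_add, zero_add]
  have := congrFun hadd (π l)
  simpa [hf, hal, hbl] using this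

/-- The Hamming automorphisms of an MDS code that fix the zero word are semilinear as soon as the
minimum weight words have all ratios: scaling such a word forces
`σ i (r * x) / σ i r = σ j x / σ j 1` for all `r`, so that all `σ i` are multiples of one and the
same multiplicative map. -/
theorem IsMDS.codeAut0_le_codeAutS [Finite F] [DecidableEq F] {k : ℕ} {C : Submodule F (ι → F)}
    (h : IsMDS k C) (hr : HasAllRatios k C) (hk : 2 ≤ k) (hkn : k < Fintype.card ι) :
    codeAut0 (C : Set (ι → F)) ≤ codeAutS (C : Set (ι → F)) := by
  classical
  rintro f ⟨⟨hg, hC⟩, h0⟩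
  obtain ⟨π, σ, hσ, hf⟩ := exists_perm_of_graphAut hg h0
  have hfC : ∀ c ∈ C, f c ∈ C := fun c hc => map_mem_of_mem_setwiseStabilizer hC hc
  have hne : ∀ i x, x ≠ 0 → σ i x ≠ 0 := fun i x hx hx0 =>
    hx ((σ i).injective (hx0.trans (hσ i).symm))
  have key : ∀ i j, i ≠ j → ∀ r x, r ≠ 0 → σ i (r * x) * σ j 1 = σ i r * σ j x := by
    intro i j hij r x hr0
    obtain ⟨c, hc, T, hT, hi, hj, hcT, hcj, hci⟩ := hr i j hij r hr0
    have hcx := Submodule.smul_mem C x hc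
    have heq : σ j 1 • f (x • c) = σ j x • f c := by
      refine h.eq_of_eqOn (K := (insert j T).map π.toEmbedding)
        (by rw [Finset.card_map, Finset.card_insert_of_notMem hj, hT])
        (Submodule.smul_mem _ _ (hfC _ hcx)) (Submodule.smul_mem _ _ (hfC _ hc)) fun s hs => ?_
      obtain ⟨t, ht, rfl⟩ := Finset.mem_map.1 hs
      simp only [Equiv.coe_toEmbedding, hf, Pi.smul_apply, smul_eq_mul]
      rcases Finset.mem_insert.1 ht with rfl | ht
      · rw [hcj, mul_one, mul_comm]
      · rw [hcT t ht, mul_zero, hσ, mul_zero, mul_zero]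
    have := congrFun heq (π i)
    simp only [Pi.smul_apply, smul_eq_mul, hf, hci] at this
    rw [mul_comm x r] at this
    linear_combination this
  have hnt : 1 < Fintype.card ι := by omega
  have : Nontrivial ι := Fintype.one_lt_card_iff_nontrivial.1 hnt
  obtain ⟨j⟩ : Nonempty ι := inferInstance
  obtain ⟨i, hij⟩ := exists_ne j
  have hj1 : σ j 1 ≠ 0 := hne j 1 one_ne_zero
  have hi1 : ∀ i, σ i 1 ≠ 0 := fun i => hne i 1 one_ne_zero
  have hone : ∀ i x, σ i x * σ j 1 = σ i 1 * σ j x := by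
    intro i x
    by_cases hij : i = j
    · rw [hij, mul_comm]
    · simpa using key i j hij 1 x one_ne_zero
  let τ : F ≃+* F :=
    { (σ j).trans (Equiv.mulRight₀ (σ j 1)⁻¹ (inv_ne_zero hj1)) with
      map_add' := fun x y => by
        simp [h.additive_of_perm hk hkn hσ hf hfC j x y, add_mul]
      map_mul' := fun x y => by
        by_cases hx : x = 0
        · simp [hx, hσ]
        have h1 := key i j hij x y hx
        have h2 := hone i x
        have h3 := hone i (x * y)
        have h4 := hi1 i
        simp only [Equiv.toFun_as_coe, Equiv.trans_apply, Equiv.mulRight₀_apply]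
        field_simp
        apply mul_left_cancel₀ h4
        linear_combination (-σ j 1) * h3 + (σ j 1) * h1 + (σ j y) * h2 }
  have hτ : ∀ x, τ x = σ j x * (σ j 1)⁻¹ := fun x => rfl
  have hτ' : ∀ i x, σ i x = σ i 1 * τ x := by
    intro i x
    rw [hτ, ← mul_assoc, ← hone i x, mul_inv_cancel_right₀ hj1]
  refine ⟨⟨τ, π, fun i => Units.mk0 (τ.symm (σ (π.symm i) 1)) ?_, fun v i => ?_⟩, hC⟩
  · simpa using hi1 _
  · have := hf v (π.symm i)
    rw [Equiv.apply_symm_apply] at this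
    rw [this, hτ', map_mul, Units.val_mk0, RingEquiv.apply_symm_apply]

end MDS

/-! ### Binary quadratic forms and the conic code -/

section Conic

variable {ι F : Type*} [Field F]

/-- The determinant of two vectors of `F²`. -/
def det₂ (v w : Fin 2 → F) : F := v 0 * w 1 - v 1 * w 0

/-- The binary quadratic form with the coefficients `a`, as a function on `F²`. -/
def quadForm (a : Fin 3 → F) (v : Fin 2 → F) : F :=
  a 0 * v 0 ^ 2 + a 1 * (v 0 * v 1) + a 2 * v 1 ^ 2

/-- Representatives of the points of the projective line over `F`, indexed by `ι`: every vector
of `F²` is a multiple of some `u i`, and no `u i` is a multiple of another. -/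
structure IsProjectiveFrame (u : ι → Fin 2 → F) : Prop where
  ne_zero : ∀ i, u i ≠ 0
  exists_smul : ∀ v, ∃ i, ∃ c : F, v = c • u i
  eq_of_smul : ∀ i j, ∀ c : F, u i = c • u j → i = j

theorem quadForm_smul (a : Fin 3 → F) (c : F) (v : Fin 2 → F) :
    quadForm a (c • v) = c ^ 2 * quadForm a v := by
  simp [quadForm]; ring

@[simp]
theorem quadForm_zero (a : Fin 3 → F) : quadForm a 0 = 0 := by simp [quadForm]

theorem quadForm_add (a b : Fin 3 → F) (v : Fin 2 → F) :
    quadForm (a + b) v = quadForm a v + quadForm b v := by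
  simp [quadForm]; ring

theorem quadForm_smul_left (c : F) (a : Fin 3 → F) (v : Fin 2 → F) :
    quadForm (c • a) v = c * quadForm a v := by
  simp [quadForm]; ring

@[simp]
theorem quadForm_zero_left (v : Fin 2 → F) : quadForm 0 v = 0 := by simp [quadForm]

/-- The coefficients of the quadratic form `v ↦ det₂ v w * det₂ v z`. -/
def detForm (w z : Fin 2 → F) : Fin 3 → F :=
  ![w 1 * z 1, -(w 1 * z 0 + w 0 * z 1), w 0 * z 0]

theorem quadForm_detForm (w z v : Fin 2 → F) :
    quadForm (detForm w z) v = det₂ v w * det₂ v z := by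
  simp [quadForm, detForm, det₂]; ring

@[simp]
theorem det₂_self (v : Fin 2 → F) : det₂ v v = 0 := by simp [det₂, mul_comm]

theorem det₂_comm (v w : Fin 2 → F) : det₂ v w = -det₂ w v := by simp [det₂]; ring

@[simp]
theorem det₂_smul_left (c : F) (v w : Fin 2 → F) : det₂ (c • v) w = c * det₂ v w := by
  simp [det₂]; ring

@[simp]
theorem det₂_smul_right (c : F) (v w : Fin 2 → F) : det₂ v (c • w) = c * det₂ v w := by
  simp [det₂]; ring

theorem det₂_add_left (v v' w : Fin 2 → F) : det₂ (v + v') w = det₂ v w + det₂ v' w := by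
  simp [det₂]; ring

theorem det₂_add_right (v w w' : Fin 2 → F) : det₂ v (w + w') = det₂ v w + det₂ v w' := by
  simp [det₂]; ring

theorem exists_smul_of_det₂_eq_zero {v w : Fin 2 → F} (hw : w ≠ 0) (h : det₂ v w = 0) :
    ∃ c : F, v = c • w := by
  rw [det₂] at h
  by_cases h0 : w 0 = 0
  · have h1 : w 1 ≠ 0 := fun h1 => hw (by ext i; fin_cases i <;> simp [h0, h1])
    refine ⟨v 1 / w 1, ?_⟩
    ext i
    fin_cases i
    · simp only [h0, mul_zero, sub_zero, mul_eq_zero, h1, or_false] at h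
      simp [h0, h]
    · simp [h1]
  · refine ⟨v 0 / w 0, ?_⟩
    ext i
    fin_cases i
    · simp [h0]
    · simp only [Fin.mk_one, Pi.smul_apply, smul_eq_mul]
      field_simp
      linear_combination -h

namespace IsProjectiveFrame

variable {u : ι → Fin 2 → F} (hu : IsProjectiveFrame u)
include hu

theorem det₂_eq_zero_iff {i j : ι} : det₂ (u i) (u j) = 0 ↔ i = j := by
  refine ⟨fun h => ?_, fun h => by rw [h, det₂_self]⟩
  obtain ⟨c, hc⟩ := exists_smul_of_det₂_eq_zero (hu.ne_zero j) h
  exact hu.eq_of_smul i j c hc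

theorem det₂_ne_zero {i j : ι} (h : i ≠ j) : det₂ (u i) (u j) ≠ 0 :=
  mt hu.det₂_eq_zero_iff.1 h

theorem smul_inj {i j : ι} {c d : F} (hc : c ≠ 0) (h : c • u i = d • u j) : i = j ∧ c = d := by
  have hij : i = j := by
    refine hu.eq_of_smul i j (c⁻¹ * d) ?_
    rw [mul_smul, ← h, smul_smul, inv_mul_cancel₀ hc, one_smul]
  subst hij
  exact ⟨rfl, smul_left_injective F (hu.ne_zero i) h⟩

/-- A form vanishing at three points of the projective line is zero, by Lagrange interpolation. -/
theorem quadForm_eq_zero {i j k : ι} (hij : i ≠ j) (hik : i ≠ k) (hjk : j ≠ k) {a : Fin 3 → F}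
    (hi : quadForm a (u i) = 0) (hj : quadForm a (u j) = 0) (hk : quadForm a (u k) = 0)
    (v : Fin 2 → F) : quadForm a v = 0 := by
  have h : quadForm a v * (det₂ (u i) (u j) * det₂ (u i) (u k) * det₂ (u j) (u k)) =
      quadForm a (u i) * (det₂ v (u j) * det₂ v (u k) * det₂ (u j) (u k)) -
      quadForm a (u j) * (det₂ v (u i) * det₂ v (u k) * det₂ (u i) (u k)) +
      quadForm a (u k) * (det₂ v (u i) * det₂ v (u j) * det₂ (u i) (u j)) := by
    simp only [quadForm, det₂]; ring
  rw [hi, hj, hk, zero_mul, zero_mul, zero_mul, sub_zero, add_zero] at h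
  refine (mul_eq_zero.1 h).resolve_right ?_
  exact mul_ne_zero (mul_ne_zero (hu.det₂_ne_zero hij) (hu.det₂_ne_zero hik)) (hu.det₂_ne_zero hjk)

end IsProjectiveFrame

/-- The conic code: the values of the binary quadratic forms at the vectors `u i`. -/
def conicCode (u : ι → Fin 2 → F) : Submodule F (ι → F) where
  carrier := {c | ∃ a, ∀ i, c i = quadForm a (u i)}
  zero_mem' := ⟨0, fun i => by simp⟩
  add_mem' := by
    rintro c c' ⟨a, ha⟩ ⟨a', ha'⟩
    exact ⟨a + a', fun i => by simp [quadForm_add, ha, ha']⟩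
  smul_mem' := by
    rintro r c ⟨a, ha⟩
    exact ⟨r • a, fun i => by simp [quadForm_smul_left, ha]⟩

theorem quadForm_mem_conicCode (u : ι → Fin 2 → F) (a : Fin 3 → F) :
    (fun i => quadForm a (u i)) ∈ conicCode u := ⟨a, fun _ => rfl⟩

theorem mem_dualCode_conicCode [Fintype ι] {u : ι → Fin 2 → F} {w : ι → F} :
    w ∈ dualCode (conicCode u) ↔ ∀ a, ∑ i, w i * quadForm a (u i) = 0 := by
  rw [mem_dualCode]
  refine ⟨fun h a => h _ (quadForm_mem_conicCode u a), ?_⟩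
  rintro h c ⟨a, ha⟩
  rw [funext ha]
  exact h a

theorem IsProjectiveFrame.isMDS_conicCode {u : ι → Fin 2 → F} (hu : IsProjectiveFrame u) :
    IsMDS 3 (conicCode u) := by
  classical
  constructor
  · rintro K hK c ⟨a, ha⟩ h0
    obtain ⟨i, j, k, hij, hik, hjk, rfl⟩ := Finset.card_eq_three.1 hK
    ext m
    rw [ha]
    refine hu.quadForm_eq_zero hij hik hjk ?_ ?_ ?_ _ <;> rw [← ha] <;> exact h0 _ (by simp)
  · intro K hK x
    obtain ⟨i, j, k, hij, hik, hjk, rfl⟩ := Finset.card_eq_three.1 hK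
    have h1 := hu.det₂_ne_zero hij
    have h2 := hu.det₂_ne_zero hik
    have h3 := hu.det₂_ne_zero hjk
    have h1' := hu.det₂_ne_zero hij.symm
    have h2' := hu.det₂_ne_zero hik.symm
    have h3' := hu.det₂_ne_zero hjk.symm
    refine ⟨_, quadForm_mem_conicCode u
      ((x i / (det₂ (u i) (u j) * det₂ (u i) (u k))) • detForm (u j) (u k) +
       (x j / (det₂ (u j) (u i) * det₂ (u j) (u k))) • detForm (u i) (u k) +
       (x k / (det₂ (u k) (u i) * det₂ (u k) (u j))) • detForm (u i) (u j)), fun m hm => ?_⟩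
    simp only [quadForm_add, quadForm_smul_left, quadForm_detForm]
    simp only [Finset.mem_insert, Finset.mem_singleton] at hm
    rcases hm with rfl | rfl | rfl <;> simp <;> field_simp

/-- The minimum weight words of the conic code are the products of two linear forms; prescribing
the ratio at the coordinates `i`, `j` leaves the choice of one of the two zeros free, and the zeros
are distinct for a suitable choice if `|F| ≥ 4`. -/
theorem IsProjectiveFrame.hasAllRatios_conicCode [Fintype F] {u : ι → Fin 2 → F}
    (hu : IsProjectiveFrame u) (hF : 4 ≤ Fintype.card F) : HasAllRatios 3 (conicCode u) := by
  classical
  intro i j hij r hr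
  obtain ⟨κ, hκ0, hκr⟩ : ∃ κ : F, κ ≠ 0 ∧ κ ^ 2 ≠ r := by
    by_contra! hcon
    have hsub : (Finset.univ : Finset F) ⊆ insert 0 (C r - X ^ 2 : F[X]).roots.toFinset := by
      intro κ _
      rw [Finset.mem_insert]
      by_cases hκ : κ = 0
      · exact Or.inl hκ
      · right
        have hp : (C r - X ^ 2 : F[X]) ≠ 0 := fun h => by
          have := congrArg (Polynomial.eval 0) h
          simp [hr] at this
        rw [Multiset.mem_toFinset, mem_roots hp]
        simp [hcon κ hκ]
    have h1 := (Finset.card_le_card hsub).trans (Finset.card_insert_le _ _)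
    have h2 := (Multiset.toFinset_card_le (C r - X ^ 2 : F[X]).roots).trans (card_roots' _)
    have h3 : (C r - X ^ 2 : F[X]).natDegree ≤ 2 := by compute_degree
    rw [Finset.card_univ] at h1
    omega
  have hdij := hu.det₂_ne_zero hij
  have hdji := hu.det₂_ne_zero hij.symm
  -- the zeros of the two linear factors
  have hz : ∀ κ : F, κ ≠ 0 → ∃ k, ∃ c : F, c ≠ 0 ∧ u i - κ • u j = c • u k ∧ k ≠ i ∧ k ≠ j := by
    intro κ hκ
    obtain ⟨k, c, hk⟩ := hu.exists_smul (u i - κ • u j)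
    have hi : det₂ (u i) (u i - κ • u j) ≠ 0 := by
      rw [sub_eq_add_neg, ← neg_smul, det₂_add_right, det₂_self, det₂_smul_right]
      simp [hκ, hdij]
    have hj : det₂ (u j) (u i - κ • u j) ≠ 0 := by
      rw [sub_eq_add_neg, ← neg_smul, det₂_add_right, det₂_smul_right, det₂_self]
      simp [hdji]
    rw [hk, det₂_smul_right] at hi hj
    refine ⟨k, c, left_ne_zero_of_mul hi, hk, ?_, ?_⟩
    · rintro rfl; simp at hi
    · rintro rfl; simp at hj
  have hκ' : r / κ ≠ 0 := div_ne_zero hr hκ0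
  obtain ⟨k, c, hc, hk, hki, hkj⟩ := hz κ hκ0
  obtain ⟨l, d, hd, hl, hli, hlj⟩ := hz (r / κ) hκ'
  have hkl : k ≠ l := by
    rintro rfl
    have h1 : det₂ (u i - κ • u j) (u i - (r / κ) • u j) = 0 := by
      rw [hk, hl]; simp
    have h2 : det₂ (u i - κ • u j) (u i - (r / κ) • u j) =
        (κ - r / κ) * det₂ (u i) (u j) := by
      simp [det₂]; ring
    rw [h2, mul_eq_zero, or_iff_left hdij, sub_eq_zero, eq_div_iff hκ0] at h1
    exact hκr (by rw [sq, h1])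
  refine ⟨_, quadForm_mem_conicCode u ((det₂ (u j) (u i) ^ 2)⁻¹ •
    detForm (u i - κ • u j) (u i - (r / κ) • u j)), {k, l}, ?_, ?_, ?_, ?_, ?_, ?_⟩
  · rw [Finset.card_pair hkl]
  · simp [hki.symm, hli.symm]
  · simp [hkj.symm, hlj.symm]
  · intro m hm
    simp only [Finset.mem_insert, Finset.mem_singleton] at hm
    rw [quadForm_smul_left, quadForm_detForm, hk, hl]
    rcases hm with rfl | rfl <;> simp
  · have h1 : ∀ κ : F, det₂ (u j) (u i - κ • u j) = det₂ (u j) (u i) := fun κ => by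
      simp [det₂]; ring
    simp only [quadForm_smul_left, quadForm_detForm, h1]
    field_simp
  · have h1 : ∀ κ : F, det₂ (u i) (u i - κ • u j) = κ * det₂ (u j) (u i) := fun κ => by
      simp [det₂]; ring
    simp only [quadForm_smul_left, quadForm_detForm, h1]
    field_simp

end Conic

/-! ### Semilinear maps acting on the conic code -/

section Action

variable {ι F : Type*} [Field F]

/-- The pairs of an invertible semilinear map of `F²` and its accompanying field automorphism. -/
def semilinearPairs (F : Type*) [Field F] : Subgroup (Equiv.Perm (Fin 2 → F) × RingAut F) where
  carrier := {p | (∀ x y, p.1 (x + y) = p.1 x + p.1 y) ∧ ∀ (c : F) x, p.1 (c • x) = p.2 c • p.1 x}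
  one_mem' := ⟨fun _ _ => rfl, fun _ _ => rfl⟩
  mul_mem' := by
    rintro ⟨f, τ⟩ ⟨g, τ'⟩ ⟨hf, hτ⟩ ⟨hg, hτ'⟩
    refine ⟨fun x y => ?_, fun c x => ?_⟩
    · simp only [Prod.mk_mul_mk, Equiv.Perm.mul_apply] at *; rw [hg, hf]
    · simp only [Prod.mk_mul_mk, Equiv.Perm.mul_apply] at *; rw [hτ', hτ]; rfl
  inv_mem' := by
    rintro ⟨f, τ⟩ ⟨hf, hτ⟩
    refine ⟨fun x y => ?_, fun c x => ?_⟩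
    · simp only [Prod.inv_mk] at *; rw [Equiv.Perm.inv_eq_iff_eq, hf]; simp
    · simp only [Prod.inv_mk] at *; rw [Equiv.Perm.inv_eq_iff_eq, hτ]; simp

theorem eq_smul_add_smul {e₁ e₂ : Fin 2 → F} (h : det₂ e₁ e₂ ≠ 0) (v : Fin 2 → F) :
    v = (det₂ v e₂ / det₂ e₁ e₂) • e₁ + (det₂ e₁ v / det₂ e₁ e₂) • e₂ := by
  ext i
  simp only [Pi.add_apply, Pi.smul_apply, smul_eq_mul]
  field_simp
  fin_cases i <;> simp [det₂] <;> ring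

theorem exists_semilinearPair {e₁ e₂ e₁' e₂' : Fin 2 → F} (h : det₂ e₁ e₂ ≠ 0)
    (h' : det₂ e₁' e₂' ≠ 0) (τ : RingAut F) : ∃ p ∈ semilinearPairs F, p.2 = τ ∧
      ∀ x y : F, p.1 (x • e₁ + y • e₂) = τ x • e₁' + τ y • e₂' := by
  have hx : ∀ (e₁ e₂ : Fin 2 → F), det₂ e₁ e₂ ≠ 0 → ∀ x y : F,
      det₂ (x • e₁ + y • e₂) e₂ / det₂ e₁ e₂ = x := by
    intro e₁ e₂ h x y
    rw [det₂_add_left, det₂_smul_left, det₂_smul_left, det₂_self, mul_zero, add_zero,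
      mul_div_cancel_right₀ _ h]
  have hy : ∀ (e₁ e₂ : Fin 2 → F), det₂ e₁ e₂ ≠ 0 → ∀ x y : F,
      det₂ e₁ (x • e₁ + y • e₂) / det₂ e₁ e₂ = y := by
    intro e₁ e₂ h x y
    rw [det₂_add_right, det₂_smul_right, det₂_smul_right, det₂_self, mul_zero, zero_add,
      mul_div_cancel_right₀ _ h]
  let g : Equiv.Perm (Fin 2 → F) :=
    { toFun := fun v => τ (det₂ v e₂ / det₂ e₁ e₂) • e₁' + τ (det₂ e₁ v / det₂ e₁ e₂) • e₂'
      invFun := fun v => τ⁻¹ (det₂ v e₂' / det₂ e₁' e₂') • e₁ +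
        τ⁻¹ (det₂ e₁' v / det₂ e₁' e₂') • e₂
      left_inv := fun v => by
        simp only []
        rw [hx _ _ h', hy _ _ h', RingAut.inv_apply, RingAut.inv_apply,
          RingEquiv.symm_apply_apply, RingEquiv.symm_apply_apply]
        exact (eq_smul_add_smul h v).symm
      right_inv := fun v => by
        simp only []
        rw [hx _ _ h, hy _ _ h, RingAut.inv_apply, RingAut.inv_apply,
          RingEquiv.apply_symm_apply, RingEquiv.apply_symm_apply]
        exact (eq_smul_add_smul h' v).symm }
  have hg : ∀ v, g v = τ (det₂ v e₂ / det₂ e₁ e₂) • e₁' + τ (det₂ e₁ v / det₂ e₁ e₂) • e₂' :=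
    fun v => rfl
  refine ⟨(g, τ), ⟨fun v w => ?_, fun c v => ?_⟩, rfl, fun x y => ?_⟩
  · simp only [hg, det₂_add_left, det₂_add_right, add_div, map_add, add_smul]
    abel
  · simp only [hg, det₂_smul_left, det₂_smul_right, mul_div_assoc, map_mul, mul_smul, smul_add]
  · simp only [hg]
    rw [hx _ _ h, hy _ _ h]

/-- Quadratic forms are carried to quadratic forms by semilinear substitutions. -/
theorem exists_quadForm_comp {p : Equiv.Perm (Fin 2 → F) × RingAut F} (hp : p ∈ semilinearPairs F)
    (a : Fin 3 → F) : ∃ a', ∀ v, quadForm a (p.1 v) = p.2 (quadForm a' v) := by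
  obtain ⟨hadd, hsmul⟩ := hp
  set P := p.1 ![1, 0] with hP
  set R := p.1 ![0, 1] with hR
  have hv : ∀ v, p.1 v = p.2 (v 0) • P + p.2 (v 1) • R := by
    intro v
    rw [hP, hR, ← hsmul, ← hsmul, ← hadd]
    congr 1
    ext i
    fin_cases i <;> simp
  refine ⟨![p.2⁻¹ (quadForm a P),
    p.2⁻¹ (2 * a 0 * P 0 * R 0 + a 1 * (P 0 * R 1 + P 1 * R 0) + 2 * a 2 * P 1 * R 1),
    p.2⁻¹ (quadForm a R)], fun v => ?_⟩
  rw [hv]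
  have hinv : ∀ x, p.2 (p.2⁻¹ x) = x := fun x => by simp [RingAut.inv_apply]
  conv_rhs => rw [quadForm]
  simp only [map_add, map_mul, map_pow, hinv, Matrix.cons_val]
  simp only [quadForm, Pi.add_apply, Pi.smul_apply, smul_eq_mul]
  ring

namespace IsProjectiveFrame

variable {u : ι → Fin 2 → F} (hu : IsProjectiveFrame u)

/-- The extension of a word, seen as a function on the vectors `u i`, to a homogeneous function of
degree two on `F²`. -/
noncomputable def homExt (c : ι → F) (v : Fin 2 → F) : F :=
  (hu.exists_smul v).choose_spec.choose ^ 2 * c (hu.exists_smul v).choose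

theorem homExt_smul_frame (c : ι → F) (a : F) (i : ι) :
    hu.homExt c (a • u i) = a ^ 2 * c i := by
  have key : ∀ j b, a • u i = b • u j → b ^ 2 * c j = a ^ 2 * c i := by
    intro j b h
    by_cases ha : a = 0
    · rw [ha, zero_smul, eq_comm] at h
      rw [(smul_eq_zero.1 h).resolve_right (hu.ne_zero j), ha]; ring
    · obtain ⟨rfl, rfl⟩ := hu.smul_inj ha h
      rfl
  exact key _ _ (hu.exists_smul (a • u i)).choose_spec.choose_spec

theorem homExt_frame (c : ι → F) (i : ι) : hu.homExt c (u i) = c i := by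
  have := hu.homExt_smul_frame c 1 i
  simpa using this

theorem homExt_smul (c : ι → F) (a : F) (v : Fin 2 → F) :
    hu.homExt c (a • v) = a ^ 2 * hu.homExt c v := by
  obtain ⟨i, b, rfl⟩ := hu.exists_smul v
  rw [smul_smul, homExt_smul_frame, homExt_smul_frame]
  ring

theorem homExt_quadForm (a : Fin 3 → F) (v : Fin 2 → F) :
    hu.homExt (fun i => quadForm a (u i)) v = quadForm a v := by
  obtain ⟨i, b, rfl⟩ := hu.exists_smul v
  rw [homExt_smul_frame, quadForm_smul]

/-- The action of the semilinear maps `(g, τ)` on the words: a word, extended to a homogeneous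
function `φ` of degree two on `F²`, is sent to `τ ∘ φ ∘ g⁻¹`. -/
noncomputable def action : semilinearPairs F →* Equiv.Perm (ι → F) :=
  MonoidHom.toHomPerm
    { toFun := fun p c i => p.1.2 (hu.homExt c (p.1.1⁻¹ (u i)))
      map_one' := by
        funext c i
        exact hu.homExt_frame c i
      map_mul' := by
        intro p p'
        funext c i
        have key : ∀ v, hu.homExt (fun i => p'.1.2 (hu.homExt c (p'.1.1⁻¹ (u i)))) v =
            p'.1.2 (hu.homExt c (p'.1.1⁻¹ v)) := by
          intro v
          obtain ⟨j, b, rfl⟩ := hu.exists_smul v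
          have h := (inv_mem p'.2).2 b (u j)
          simp only [Prod.fst_inv, Prod.snd_inv] at h
          rw [homExt_smul_frame, h, homExt_smul, map_mul, map_pow, RingAut.inv_apply,
            RingEquiv.apply_symm_apply]
        exact congrArg p.1.2 (key _).symm }

theorem action_apply (p : semilinearPairs F) (c : ι → F) (i : ι) :
    hu.action p c i = p.1.2 (hu.homExt c (p.1.1⁻¹ (u i))) := rfl

theorem action_apply_of_smul {p : semilinearPairs F} {i j : ι} {a : F}
    (h : p.1.1 (u j) = a • u i) (c : ι → F) :
    hu.action p c i = (a ^ 2)⁻¹ * p.1.2 (c j) := by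
  have hp0 : p.1.1 0 = 0 := by simpa using p.2.2 0 0
  have ha : a ≠ 0 := by
    rintro rfl
    rw [zero_smul, ← hp0] at h
    exact hu.ne_zero j (p.1.1.injective h)
  have h1 : u i = p.1.1 ((p.1.2.symm a)⁻¹ • u j) := by
    rw [p.2.2, h, map_inv₀, RingEquiv.apply_symm_apply, smul_smul, inv_mul_cancel₀ ha, one_smul]
  rw [action_apply, h1, Equiv.Perm.inv_def, Equiv.symm_apply_apply, homExt_smul_frame,
    map_mul, map_pow, map_inv₀, RingEquiv.apply_symm_apply, inv_pow]

theorem exists_perm_of_semilinearPair [Finite ι] (hu : IsProjectiveFrame u)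
    (p : semilinearPairs F) :
    ∃ (π : Equiv.Perm ι) (a : ι → Fˣ), ∀ j, p.1.1 (u j) = (a j : F) • u (π j) := by
  choose π a h using fun j => hu.exists_smul (p.1.1 (u j))
  have hp0 : p.1.1 0 = 0 := by simpa using p.2.2 0 0
  have ha : ∀ j, a j ≠ 0 := fun j h0 => by
    have h1 := h j
    rw [h0, zero_smul, ← hp0] at h1
    exact hu.ne_zero j (p.1.1.injective h1)
  have hinj : Function.Injective π := by
    intro i j hij
    refine hu.eq_of_smul i j (p.1.2.symm (a i / a j)) (p.1.1.injective ?_)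
    rw [p.2.2, RingEquiv.apply_symm_apply, h, h, hij, smul_smul, div_mul_cancel₀ _ (ha j)]
  exact ⟨Equiv.ofBijective π (Finite.injective_iff_bijective.1 hinj),
    fun j => Units.mk0 (a j) (ha j), h⟩

theorem action_eq [Finite ι] (p : semilinearPairs F) :
    ∃ (π : Equiv.Perm ι) (d : ι → Fˣ),
      ∀ c i, hu.action p c i = p.1.2 ((d i : F) * c (π.symm i)) := by
  obtain ⟨π, a, h⟩ := hu.exists_perm_of_semilinearPair p
  refine ⟨π, fun i => Units.mk0 (p.1.2.symm ((a (π.symm i) : F) ^ 2)⁻¹) (by simp), fun c i => ?_⟩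
  have h1 := h (π.symm i)
  rw [Equiv.apply_symm_apply] at h1
  rw [hu.action_apply_of_smul h1, map_mul, Units.val_mk0, RingEquiv.apply_symm_apply]

theorem action_mem_conicCode (p : semilinearPairs F) {c : ι → F} (hc : c ∈ conicCode u) :
    hu.action p c ∈ conicCode u := by
  obtain ⟨a, ha⟩ := hc
  obtain ⟨a', ha'⟩ := exists_quadForm_comp (inv_mem p.2) a
  refine ⟨a', fun i => ?_⟩
  rw [action_apply, funext ha, homExt_quadForm]
  have := ha' (u i)
  simp only [Prod.fst_inv, Prod.snd_inv] at this
  rw [this, RingAut.inv_apply, RingEquiv.apply_symm_apply]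

theorem action_mem_setwiseStabilizer (p : semilinearPairs F) :
    hu.action p ∈ setwiseStabilizer (conicCode u : Set (ι → F)) := by
  refine mem_setwiseStabilizer_of_forall (fun c hc => hu.action_mem_conicCode p hc)
    fun c hc => ?_
  rw [← map_inv]
  exact hu.action_mem_conicCode p⁻¹ hc

theorem action_mem_codeAutS [Finite ι] (p : semilinearPairs F) :
    hu.action p ∈ codeAutS (conicCode u : Set (ι → F)) :=
  ⟨⟨p.1.2, hu.action_eq p⟩, hu.action_mem_setwiseStabilizer p⟩

theorem action_injective [CharP F 2] : Function.Injective hu.action := by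
  classical
  rw [injective_iff_map_eq_one]
  intro p hp
  have h1 : ∀ j, p.1.1 (u j) = u j ∧ ∀ x, p.1.2 x = x := by
    intro j
    obtain ⟨i, a, h⟩ := hu.exists_smul (p.1.1 (u j))
    have hc : ∀ c : ι → F, (a ^ 2)⁻¹ * p.1.2 (c j) = c i := fun c => by
      rw [← hu.action_apply_of_smul h, hp]; rfl
    have hij : i = j := by
      by_contra hij
      have h2 := hc (Pi.single j 1)
      have h3 := hc (Pi.single i 1)
      rw [Pi.single_eq_same, Pi.single_eq_of_ne (Ne.symm hij), map_zero, mul_zero] at h3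
      exact zero_ne_one h3
    subst hij
    have h2 := hc (fun _ => 1)
    simp only [map_one, mul_one] at h2
    have ha : a = 1 := by
      have h3 : a ^ 2 = 1 ^ 2 := by rw [one_pow, ← inv_inv (a ^ 2), h2, inv_one]
      exact (frobenius_inj F 2) h3
    refine ⟨by rw [h, ha, one_smul], fun x => ?_⟩
    have := hc (fun _ => x)
    rwa [h2, one_mul] at this
  ext v i
  · obtain ⟨j, b, rfl⟩ := hu.exists_smul v
    rw [p.2.2, (h1 j).1, (h1 j).2]
    rfl
  · obtain ⟨j, -, -⟩ := hu.exists_smul 0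
    exact (h1 j).2 _

/-- A form that vanishes at exactly one point of the projective line is a multiple of the square of
a linear form. -/
theorem quadForm_eq_of_unique_zero (hu : IsProjectiveFrame u) {a : Fin 3 → F} {i j : ι}
    (hij : i ≠ j) (h : ∀ k, quadForm a (u k) = 0 ↔ k = i) :
    ∃ A : F, ∀ v, quadForm a v = A * (det₂ v (u i) * det₂ v (u i)) := by
  have hi := (h i).2 rfl
  set w := u j with hw
  have hd : det₂ w (u i) ≠ 0 := hu.det₂_ne_zero hij.symm
  -- the polar form of `u i` and `w`; if it did not vanish, there would be a second zero
  set B := quadForm a (u i + w) - quadForm a (u i) - quadForm a w with hB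
  have hBexp : B = 2 * a 0 * u i 0 * w 0 + a 1 * (u i 0 * w 1 + u i 1 * w 0) +
      2 * a 2 * u i 1 * w 1 := by
    rw [hB]; simp [quadForm]; ring
  have hexp : ∀ x y : F, quadForm a (x • u i + y • w) =
      x ^ 2 * quadForm a (u i) + x * y * B + y ^ 2 * quadForm a w := by
    intro x y
    rw [hBexp]; simp [quadForm]; ring
  have hB0 : B = 0 := by
    have hz : quadForm a (quadForm a w • u i + (-B) • w) = 0 := by
      rw [hexp, hi]; ring
    have hdz : det₂ (quadForm a w • u i + (-B) • w) (u i) = -B * det₂ w (u i) := by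
      rw [det₂_add_left, det₂_smul_left, det₂_smul_left, det₂_self, mul_zero, zero_add]
    obtain ⟨k, b, hk⟩ := hu.exists_smul (quadForm a w • u i + (-B) • w)
    have h0 : det₂ (b • u k) (u i) = 0 := by
      rw [hk, quadForm_smul, mul_eq_zero] at hz
      rcases hz with hz | hz
      · rw [pow_eq_zero_iff two_ne_zero] at hz
        rw [hz, det₂_smul_left, zero_mul]
      · rw [(h k).1 hz, det₂_smul_left, det₂_self, mul_zero]
    rw [← hk, hdz, mul_eq_zero, or_iff_left hd, neg_eq_zero] at h0
    exact h0
  refine ⟨quadForm a w / det₂ w (u i) ^ 2, fun v => ?_⟩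
  have h1 := hexp (det₂ v w / det₂ (u i) w) (det₂ (u i) v / det₂ (u i) w)
  rw [← eq_smul_add_smul (hu.det₂_ne_zero hij) v, hi, hB0] at h1
  rw [h1, det₂_comm v (u i), det₂_comm w (u i)]
  field_simp
  ring

/-- A form that vanishes at two points is determined up to a factor. -/
theorem quadForm_eq_of_two_zeros (hu : IsProjectiveFrame u) {a : Fin 3 → F} {i j k : ι}
    (hij : i ≠ j) (hik : i ≠ k) (hjk : j ≠ k) (hi : quadForm a (u i) = 0)
    (hj : quadForm a (u j) = 0) :
    ∃ B : F, ∀ v, quadForm a v = B * (det₂ v (u i) * det₂ v (u j)) := by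
  have h1 := hu.det₂_ne_zero hik.symm
  have h2 := hu.det₂_ne_zero hjk.symm
  refine ⟨quadForm a (u k) / (det₂ (u k) (u i) * det₂ (u k) (u j)), fun v => ?_⟩
  have := hu.quadForm_eq_zero hij hik hjk (a := a + (-(quadForm a (u k) /
    (det₂ (u k) (u i) * det₂ (u k) (u j)))) • detForm (u i) (u j)) ?_ ?_ ?_ v
  · rw [quadForm_add, quadForm_smul_left, quadForm_detForm] at this
    linear_combination this
  · rw [quadForm_add, quadForm_smul_left, quadForm_detForm, hi]; simp
  · rw [quadForm_add, quadForm_smul_left, quadForm_detForm, hj]; simp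
  · rw [quadForm_add, quadForm_smul_left, quadForm_detForm]
    field_simp
    ring

theorem exists_three (hu : IsProjectiveFrame u) : ∃ i j k : ι, i ≠ j ∧ i ≠ k ∧ j ≠ k := by
  obtain ⟨i, a, hi⟩ := hu.exists_smul ![1, 0]
  obtain ⟨j, b, hj⟩ := hu.exists_smul ![0, 1]
  obtain ⟨k, c, hk⟩ := hu.exists_smul ![1, 1]
  have key : ∀ {v w : Fin 2 → F} {i j : ι} {a b : F}, v = a • u i → w = b • u j →
      det₂ v w ≠ 0 → i ≠ j := by
    rintro v w i j a b rfl rfl h rfl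
    simp at h
  exact ⟨i, j, k, key hi hj (by simp [det₂]), key hi hk (by simp [det₂]),
    key hj hk (by simp [det₂])⟩

end IsProjectiveFrame

end Action

/-! ### The automorphism groups of the conic code -/

section ConicAut

variable {ι F : Type*} [Field F]

namespace IsProjectiveFrame

variable {u : ι → Fin 2 → F}

/-- A monomial-semilinear transform that preserves the conic code agrees, on the code, with the
action of a semilinear map. The three products of the linear forms vanishing at `u i` and
`u j` span the code and are sent, up to factors `A`, `D`, `B`, to the analogous products for `π i`
and `π j`; the pointwise relation between them gives `B ^ 2 = A * D`, and a semilinear map with the same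
three factors is found by extracting square roots. -/
theorem exists_action_eqOn_conicCode [Finite F] [CharP F 2] (hu : IsProjectiveFrame u)
    {f : Equiv.Perm (ι → F)} {τ : F ≃+* F} {π : Equiv.Perm ι} {d : ι → Fˣ}
    (h : ∀ v i, f v i = τ ((d i : F) * v (π.symm i)))
    (hC : ∀ c ∈ conicCode u, f c ∈ conicCode u) :
    ∃ p : semilinearPairs F, p.1.2 = τ ∧ ∀ c ∈ conicCode u, hu.action p c = f c := by
  have hsq : ∀ x : F, ∃ y, y ^ 2 = x := (bijective_frobenius F 2).2
  obtain ⟨i, j, m, hij, him, hjm⟩ := hu.exists_three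
  have hf : ∀ v k, f v (π k) = τ ((d (π k) : F) * v k) := fun v k => by
    rw [h, Equiv.symm_apply_apply]
  have hzero : ∀ v k, f v (π k) = 0 ↔ v k = 0 := fun v k => by simp [hf]
  have hform : ∀ a, ∃ a', ∀ k, f (fun k => quadForm a (u k)) k = quadForm a' (u k) := fun a =>
    hC _ (quadForm_mem_conicCode u a)
  have hπij : π i ≠ π j := π.injective.ne hij
  have hπim : π i ≠ π m := π.injective.ne him
  have hπjm : π j ≠ π m := π.injective.ne hjm
  have hsquare : ∀ i j, i ≠ j → ∃ A : F, A ≠ 0 ∧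
      ∀ k, f (fun k => quadForm (detForm (u i) (u i)) (u k)) k =
        A * (det₂ (u k) (u (π i)) * det₂ (u k) (u (π i))) := by
    intro i j hij
    obtain ⟨a, ha⟩ := hform (detForm (u i) (u i))
    have hz : ∀ k, quadForm a (u k) = 0 ↔ k = π i := by
      intro k
      obtain ⟨k, rfl⟩ := π.surjective k
      rw [← ha, hzero, quadForm_detForm, mul_self_eq_zero, hu.det₂_eq_zero_iff,
        π.injective.eq_iff]
    obtain ⟨A, hA⟩ := hu.quadForm_eq_of_unique_zero (π.injective.ne hij) hz
    refine ⟨A, ?_, fun k => by rw [ha, hA]⟩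
    rintro rfl
    have := hA (u (π j))
    rw [zero_mul, hz] at this
    exact hij (π.injective this).symm
  obtain ⟨A, hA0, hA⟩ := hsquare i j hij
  obtain ⟨D, hD0, hD⟩ := hsquare j i hij.symm
  obtain ⟨B, hB⟩ : ∃ B : F, ∀ k, f (fun k => quadForm (detForm (u i) (u j)) (u k)) k =
        B * (det₂ (u k) (u (π i)) * det₂ (u k) (u (π j))) := by
    obtain ⟨a, ha⟩ := hform (detForm (u i) (u j))
    obtain ⟨B, hB⟩ := hu.quadForm_eq_of_two_zeros hπij hπim hπjm (a := a)
      (by rw [← ha, hzero, quadForm_detForm]; simp) (by rw [← ha, hzero, quadForm_detForm]; simp)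
    exact ⟨B, fun k => by rw [ha, hB]⟩
  have hBAD : B ^ 2 = A * D := by
    have h1 := hu.det₂_ne_zero hπim.symm
    have h2 := hu.det₂_ne_zero hπjm.symm
    have h3 : f (fun k => quadForm (detForm (u i) (u j)) (u k)) (π m) ^ 2 =
        f (fun k => quadForm (detForm (u i) (u i)) (u k)) (π m) *
        f (fun k => quadForm (detForm (u j) (u j)) (u k)) (π m) := by
      simp only [hf, quadForm_detForm, map_mul]
      ring
    rw [hA, hB, hD] at h3
    have h4 : (det₂ (u (π m)) (u (π i)) * det₂ (u (π m)) (u (π j))) ^ 2 ≠ 0 :=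
      pow_ne_zero _ (mul_ne_zero h1 h2)
    apply mul_right_cancel₀ h4
    linear_combination h3
  obtain ⟨s, rfl⟩ := hsq A
  obtain ⟨t, rfl⟩ := hsq D
  have hs : s ≠ 0 := by rintro rfl; simp at hA0
  have ht : t ≠ 0 := by rintro rfl; simp at hD0
  have hBst : B = s * t := frobenius_inj F 2 (by simp only [frobenius_def]; rw [hBAD, mul_pow])
  have hdij := hu.det₂_ne_zero hij
  have hdπ := hu.det₂_ne_zero hπij
  set κ := τ (det₂ (u i) (u j)) / det₂ (u (π i)) (u (π j)) with hκ
  have hκ0 : κ ≠ 0 := div_ne_zero (by simpa using hdij) hdπ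
  have hκd : κ * det₂ (u (π i)) (u (π j)) = τ (det₂ (u i) (u j)) := div_mul_cancel₀ _ hdπ
  obtain ⟨p, hp, hpτ, hpg⟩ := exists_semilinearPair hdij (e₁' := (κ / t) • u (π i))
    (e₂' := (κ / s) • u (π j)) (by
      rw [det₂_smul_left, det₂_smul_right]
      exact mul_ne_zero (div_ne_zero hκ0 ht) (mul_ne_zero (div_ne_zero hκ0 hs) hdπ)) τ
  refine ⟨⟨p, hp⟩, hpτ, ?_⟩
  -- the action on the three products of linear forms
  have hact : ∀ a k, hu.action ⟨p, hp⟩ (fun k => quadForm a (u k)) k =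
      τ (quadForm a (p.1⁻¹ (u k))) := fun a k => by
    rw [action_apply, homExt_quadForm, hpτ]
  have hcoord : ∀ k, ∃ x y : F, p.1⁻¹ (u k) = x • u i + y • u j ∧
      s * det₂ (u k) (u (π i)) = -(τ y * τ (det₂ (u i) (u j))) ∧
      t * det₂ (u k) (u (π j)) = τ x * τ (det₂ (u i) (u j)) := by
    intro k
    have h1 := eq_smul_add_smul hdij (p.1⁻¹ (u k))
    set x := det₂ (p.1⁻¹ (u k)) (u j) / det₂ (u i) (u j)
    set y := det₂ (u i) (p.1⁻¹ (u k)) / det₂ (u i) (u j)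
    have h2 : u k = τ x • (κ / t) • u (π i) + τ y • (κ / s) • u (π j) := by
      rw [← hpg, ← h1, Equiv.Perm.inv_def, Equiv.apply_symm_apply]
    refine ⟨x, y, h1, ?_, ?_⟩
    · rw [h2]
      simp only [det₂_add_left, det₂_smul_left, det₂_self]
      rw [det₂_comm (u (π j)), ← hκd]
      field_simp
      ring
    · rw [h2]
      simp only [det₂_add_left, det₂_smul_left, det₂_self]
      rw [← hκd]
      field_simp
      ring
  have hii : ∀ x y : F, det₂ (x • u i + y • u j) (u i) = -(y * det₂ (u i) (u j)) := fun x y => by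
    simp [det₂_add_left, det₂_comm (u j)]
  have hjj : ∀ x y : F, det₂ (x • u i + y • u j) (u j) = x * det₂ (u i) (u j) := fun x y => by
    simp [det₂_add_left]
  have e1 : hu.action ⟨p, hp⟩ (fun k => quadForm (detForm (u i) (u i)) (u k)) =
      f (fun k => quadForm (detForm (u i) (u i)) (u k)) := by
    funext k
    obtain ⟨x, y, hxy, h1, h2⟩ := hcoord k
    rw [hact, hA, hxy, quadForm_detForm, hii, map_mul, map_neg, map_mul, ← h1]
    ring
  have e2 : hu.action ⟨p, hp⟩ (fun k => quadForm (detForm (u j) (u j)) (u k)) =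
      f (fun k => quadForm (detForm (u j) (u j)) (u k)) := by
    funext k
    obtain ⟨x, y, hxy, h1, h2⟩ := hcoord k
    rw [hact, hD, hxy, quadForm_detForm, hjj, map_mul, map_mul, ← h2]
    ring
  have e3 : hu.action ⟨p, hp⟩ (fun k => quadForm (detForm (u i) (u j)) (u k)) =
      f (fun k => quadForm (detForm (u i) (u j)) (u k)) := by
    funext k
    obtain ⟨x, y, hxy, h1, h2⟩ := hcoord k
    rw [hact, hB, hxy, quadForm_detForm, hjj, hii, map_mul, map_mul, map_neg, map_mul, ← h1, ← h2,
      hBst]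
    ring
  rintro c ⟨a, ha⟩
  -- every form is a combination of the three products
  obtain ⟨x, y, z, hxyz⟩ : ∃ x y z : F, ∀ v, quadForm a v =
      x * quadForm (detForm (u i) (u i)) v + y * quadForm (detForm (u j) (u j)) v +
      z * quadForm (detForm (u i) (u j)) v := by
    refine ⟨quadForm a (u j) / det₂ (u i) (u j) ^ 2, quadForm a (u i) / det₂ (u i) (u j) ^ 2,
      -(quadForm a (u i + u j) - quadForm a (u i) - quadForm a (u j)) / det₂ (u i) (u j) ^ 2,
      fun v => ?_⟩
    simp only [quadForm_detForm]
    field_simp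
    simp only [quadForm, det₂, Pi.add_apply]
    ring
  funext k
  have hc : c = fun k => quadForm a (u k) := funext ha
  have h1 := congrFun e1 k
  have h2 := congrFun e2 k
  have h3 := congrFun e3 k
  rw [h, hact] at h1 h2 h3
  rw [hc, h, hact, hxyz, hxyz, mul_add, mul_add]
  simp only [map_add, map_mul] at h1 h2 h3 ⊢
  linear_combination τ x * h1 + τ y * h2 + τ z * h3

/-- Semilinear transforms are determined by their values on the conic code, because the code
has words with a single zero at any given coordinate. -/
theorem eq_of_eqOn_conicCode (hu : IsProjectiveFrame u) {τ : F ≃+* F} {f g : Equiv.Perm (ι → F)}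
    {π π' : Equiv.Perm ι} {d d' : ι → Fˣ} (hf : ∀ v i, f v i = τ ((d i : F) * v (π.symm i)))
    (hg : ∀ v i, g v i = τ ((d' i : F) * v (π'.symm i)))
    (h : ∀ c ∈ conicCode u, f c = g c) : f = g := by
  have hπ : ∀ i, π.symm i = π'.symm i := by
    intro i
    have h1 := congrFun (h _ (quadForm_mem_conicCode u
      (detForm (u (π.symm i)) (u (π.symm i))))) i
    rw [hf, hg, quadForm_detForm, quadForm_detForm, det₂_self, mul_zero, mul_zero, map_zero,
      eq_comm, map_eq_zero, mul_eq_zero, or_iff_right (d' i).ne_zero, mul_self_eq_zero,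
      hu.det₂_eq_zero_iff] at h1
    exact h1.symm
  have hd : ∀ i, d i = d' i := by
    intro i
    obtain ⟨j, hj⟩ : ∃ j, π.symm i ≠ j := by
      obtain ⟨k, l, -, hkl, -⟩ := hu.exists_three
      by_cases hk : π.symm i = k
      · exact ⟨l, by rwa [hk]⟩
      · exact ⟨k, hk⟩
    have h1 := congrFun (h _ (quadForm_mem_conicCode u (detForm (u j) (u j)))) i
    rw [hf, hg, ← hπ, quadForm_detForm] at h1
    have h2 := hu.det₂_ne_zero hj
    exact Units.ext (mul_right_cancel₀ (mul_ne_zero h2 h2) (τ.injective h1))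
  ext v i
  rw [hf, hg, hπ, hd]

theorem exists_action_eq [Finite ι] [Finite F] [CharP F 2] (hu : IsProjectiveFrame u)
    {f : Equiv.Perm (ι → F)} {τ : F ≃+* F} {π : Equiv.Perm ι} {d : ι → Fˣ}
    (h : ∀ v i, f v i = τ ((d i : F) * v (π.symm i)))
    (hC : f ∈ setwiseStabilizer (conicCode u : Set (ι → F))) :
    ∃ p : semilinearPairs F, p.1.2 = τ ∧ hu.action p = f := by
  obtain ⟨p, hp, heq⟩ := hu.exists_action_eqOn_conicCode h
    fun c hc => map_mem_of_mem_setwiseStabilizer hC hc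
  obtain ⟨π', d', h'⟩ := hu.action_eq p
  rw [hp] at h'
  exact ⟨p, hp, hu.eq_of_eqOn_conicCode h' h heq⟩

end IsProjectiveFrame

/-- The accompanying automorphism of a semilinear map is unique. -/
theorem semilinearPairs_ext {p p' : semilinearPairs F} (h : p.1.1 = p'.1.1) : p = p' := by
  refine Subtype.ext (Prod.ext h ?_)
  ext c
  have h1 := p.2.2 c ![1, 0]
  rw [h, p'.2.2] at h1
  refine (smul_left_injective F ?_ h1).symm
  intro h0
  have h2 : p'.1.1 0 = 0 := by simpa using p'.2.2 0 0
  have := congrFun (p'.1.1.injective (h0.trans h2.symm)) 0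
  simp at this

theorem nonempty_semilinearPairs_mulEquiv :
    Nonempty (semilinearPairs F ≃* generalSemilinearGroup 2 F) := by
  let φ : semilinearPairs F →* generalSemilinearGroup 2 F :=
    { toFun := fun p => ⟨p.1.1, p.2.1, p.1.2, p.2.2⟩
      map_one' := rfl
      map_mul' := fun _ _ => rfl }
  refine ⟨MulEquiv.ofBijective φ ⟨fun p p' h => semilinearPairs_ext (congrArg Subtype.val h), ?_⟩⟩
  rintro ⟨g, hadd, τ, h⟩
  exact ⟨⟨(g, τ), hadd, h⟩, rfl⟩

theorem nonempty_mulEquiv_of_range_eq {G H K : Type*} [Group G] [Group H] [Group K]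
    (φ : G →* K) (hφ : Function.Injective φ) {S : Subgroup K} (hS : ∀ x, x ∈ S ↔ ∃ g, φ g = x)
    (e : G ≃* H) : Nonempty (S ≃* H) := by
  have : S = φ.range := by
    ext x
    rw [hS, MonoidHom.mem_range]
  exact ⟨((MulEquiv.subgroupCongr this).trans (MonoidHom.ofInjective hφ).symm).trans e⟩

theorem IsProjectiveFrame.nonempty_codeAutS_mulEquiv [Finite ι] [Finite F] [CharP F 2]
    {u : ι → Fin 2 → F} (hu : IsProjectiveFrame u) :
    Nonempty (codeAutS (conicCode u : Set (ι → F)) ≃* generalSemilinearGroup 2 F) := by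
  obtain ⟨e⟩ := nonempty_semilinearPairs_mulEquiv (F := F)
  refine nonempty_mulEquiv_of_range_eq hu.action hu.action_injective (fun f => ⟨?_, ?_⟩) e
  · rintro ⟨⟨τ, π, d, h⟩, hC⟩
    obtain ⟨p, -, hp⟩ := hu.exists_action_eq h hC
    exact ⟨p, hp⟩
  · rintro ⟨p, rfl⟩
    exact hu.action_mem_codeAutS p

/-- The linear maps among the semilinear maps. -/
noncomputable def linearPairs (F : Type*) [Field F] : GL (Fin 2) F →* semilinearPairs F where
  toFun M := ⟨((LinearMap.GeneralLinearGroup.generalLinearEquiv F (Fin 2 → F)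
      (Matrix.GeneralLinearGroup.toLin M)).toEquiv, 1),
    fun x y => map_add (LinearMap.GeneralLinearGroup.generalLinearEquiv F (Fin 2 → F)
      (Matrix.GeneralLinearGroup.toLin M)) x y,
    fun c x => map_smul (LinearMap.GeneralLinearGroup.generalLinearEquiv F (Fin 2 → F)
      (Matrix.GeneralLinearGroup.toLin M)) c x⟩
  map_one' := by
    simp only [map_one]
    rfl
  map_mul' M N := by
    simp only [map_mul]
    refine Subtype.ext (Prod.ext rfl ?_)
    simp

theorem linearPairs_injective : Function.Injective (linearPairs F) := by
  intro M N h
  apply (Matrix.GeneralLinearGroup.toLin (n := Fin 2) (R := F)).injective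
  apply (LinearMap.GeneralLinearGroup.generalLinearEquiv F (Fin 2 → F)).injective
  apply LinearEquiv.toEquiv_injective
  exact congrArg (fun p => p.1.1) h

theorem exists_linearPairs_eq {p : semilinearPairs F} (hp : p.1.2 = 1) :
    ∃ M, linearPairs F M = p := by
  let e : (Fin 2 → F) ≃ₗ[F] (Fin 2 → F) :=
    { p.1.1 with
      map_add' := p.2.1
      map_smul' := fun c x => by
        have := p.2.2 c x
        rw [hp] at this
        exact this }
  refine ⟨(Matrix.GeneralLinearGroup.toLin (n := Fin 2) (R := F)).symm
    ((LinearMap.GeneralLinearGroup.generalLinearEquiv F (Fin 2 → F)).symm e), ?_⟩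
  refine Subtype.ext (Prod.ext ?_ hp.symm)
  simp only [linearPairs, MonoidHom.coe_mk, OneHom.coe_mk, MulEquiv.apply_symm_apply]
  rfl

theorem IsProjectiveFrame.nonempty_codeAutM_mulEquiv [Finite ι] [Finite F] [CharP F 2]
    {u : ι → Fin 2 → F} (hu : IsProjectiveFrame u) :
    Nonempty (codeAutM (conicCode u : Set (ι → F)) ≃* GL (Fin 2) F) := by
  refine nonempty_mulEquiv_of_range_eq (hu.action.comp (linearPairs F))
    (hu.action_injective.comp linearPairs_injective) (fun f => ⟨?_, ?_⟩) (MulEquiv.refl _)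
  · rintro ⟨⟨π, d, h⟩, hC⟩
    obtain ⟨p, hp, hpf⟩ := hu.exists_action_eq (τ := RingEquiv.refl F) h hC
    obtain ⟨M, rfl⟩ := exists_linearPairs_eq hp
    exact ⟨M, hpf⟩
  · rintro ⟨M, rfl⟩
    exact ⟨hu.action_eq (linearPairs F M), hu.action_mem_setwiseStabilizer _⟩

end ConicAut

/-! ### The group of the Kasami code -/

section Kasami

variable {ι J F : Type*} [Field F]

/-- The Hamming automorphisms fixing zero of the conic code and of its dual are semilinear. -/
theorem IsProjectiveFrame.codeAut0_le_codeAutS [Fintype ι] [Fintype F] [DecidableEq F]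
    {u : ι → Fin 2 → F} (hu : IsProjectiveFrame u)
    (hF : (∀ x : F, x = 0 ∨ x = 1) ∨ 4 ≤ Fintype.card F)
    (hι : Fintype.card ι = Fintype.card F + 1) :
    codeAut0 (conicCode u : Set (ι → F)) ≤ codeAutS (conicCode u : Set (ι → F)) ∧
    codeAut0 (dualCode (conicCode u) : Set (ι → F)) ≤
      codeAutS (dualCode (conicCode u) : Set (ι → F)) := by
  rcases hF with hF | hF
  · exact ⟨codeAut0_le_codeAutS_of_binary hF _, codeAut0_le_codeAutS_of_binary hF _⟩
  · have h1 := hu.isMDS_conicCode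
    have h2 := hu.hasAllRatios_conicCode hF
    have hkl : 3 + (Fintype.card ι - 3) = Fintype.card ι := by omega
    exact ⟨h1.codeAut0_le_codeAutS h2 (by omega) (by omega),
      (h1.dualCode hkl).codeAut0_le_codeAutS (h2.dualCode h1 hkl) (by omega) (by omega)⟩

/-- A permutation of `F²` preserves the relations among quadratic forms if it sends every set of
vectors on which all quadratic forms sum to zero to such a set. -/
def PreservesRelations (p : Equiv.Perm (Fin 2 → F)) : Prop :=
  ∀ A : Finset (Fin 2 → F), (∀ a, ∑ v ∈ A, quadForm a v = 0) → ∀ a, ∑ v ∈ A, quadForm a (p v) = 0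

/-- Three distinct nonzero vectors form a relation exactly when they are proportional and add up to
zero; so proportional vectors are sent to proportional vectors. -/
theorem PreservesRelations.det₂_eq_zero [CharP F 2] {p : Equiv.Perm (Fin 2 → F)}
    (hp : PreservesRelations p) {v w : Fin 2 → F} (hv : v ≠ 0) (hw : w ≠ 0) (h : det₂ v w = 0) :
    det₂ (p v) (p w) = 0 := by
  classical
  by_cases hvw : v = w
  · rw [hvw, det₂_self]
  have h2 : (2 : F) = 0 := CharTwo.two_eq_zero
  have hsum : ∀ φ : (Fin 2 → F) → F,
      ∑ x ∈ {v, w, v + w}, φ x = φ v + φ w + φ (v + w) := by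
    intro φ
    rw [Finset.sum_insert (by simp [hvw, hw]), Finset.sum_insert (by simp [hv]),
      Finset.sum_singleton, add_assoc]
  have h1 := hp {v, w, v + w} (by
    intro a
    rw [hsum]
    obtain ⟨c, rfl⟩ := exists_smul_of_det₂_eq_zero hw h
    simp only [quadForm, Pi.add_apply, Pi.smul_apply, smul_eq_mul]
    linear_combination
      (1 + c + c ^ 2) * (a 0 * w 0 ^ 2 + a 1 * (w 0 * w 1) + a 2 * w 1 ^ 2) * h2)
  simp only [hsum] at h1
  have hx := h1 ![1, 0, 0]
  have hxy := h1 ![0, 1, 0]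
  have hy := h1 ![0, 0, 1]
  simp only [quadForm, Matrix.cons_val, one_mul, zero_mul, add_zero, zero_add] at hx hxy hy
  have hsq : ∀ x y z : F, x ^ 2 + y ^ 2 + z ^ 2 = 0 → z = x + y := by
    intro x y z hxyz
    have : (z + (x + y)) ^ 2 = 0 := by
      linear_combination hxyz + (x * y + z * x + z * y) * h2
    rw [pow_eq_zero_iff two_ne_zero] at this
    linear_combination this - (x + y) * h2
  have hx' := hsq _ _ _ hx
  have hy' := hsq _ _ _ hy
  rw [hx', hy'] at hxy
  rw [det₂]
  linear_combination hxy - (p v 0 * p v 1 + p w 0 * p w 1 + p v 1 * p w 0) * h2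

/-- A permutation that preserves the relations in both directions permutes the lines through the
origin, hence acts on the words of length `ι` through the words of weight one. The result is an
automorphism of the dual of the conic code, so it is semilinear, and so is the permutation. -/
theorem PreservesRelations.exists_semilinearPair [Fintype ι] [Finite F] [DecidableEq F]
    [CharP F 2] {u : ι → Fin 2 → F} (hu : IsProjectiveFrame u)
    (hM : codeAut0 (dualCode (conicCode u) : Set (ι → F)) ≤
      codeAutS (dualCode (conicCode u) : Set (ι → F)))
    {p : Equiv.Perm (Fin 2 → F)} (hp0 : p 0 = 0)
    (hp : PreservesRelations p) (hp' : PreservesRelations p.symm) :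
    ∃ g : semilinearPairs F, g.1.1 = p := by
  classical
  have hpne : ∀ {v}, v ≠ 0 → p v ≠ 0 := fun hv h0 => hv (p.injective (h0.trans hp0.symm))
  have hune := hu.ne_zero
  -- the permutation of the lines
  choose π b hπ using fun i => hu.exists_smul (p (u i))
  have hπinj : Function.Injective π := by
    intro i j hij
    rw [← hu.det₂_eq_zero_iff]
    have h1 : det₂ (p (u i)) (p (u j)) = 0 := by rw [hπ, hπ, hij]; simp
    have h2 := hp'.det₂_eq_zero (hpne (hune i)) (hpne (hune j)) h1
    simpa using h2
  have hs : ∀ i (c : F), ∃ s : F, p (c • u i) = s • u (π i) := by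
    intro i c
    by_cases hc : c = 0
    · exact ⟨0, by rw [hc, zero_smul, zero_smul, hp0]⟩
    · obtain ⟨s, hs⟩ := exists_smul_of_det₂_eq_zero (hpne (hune i))
        (hp.det₂_eq_zero (smul_ne_zero hc (hune i)) (hune i) (by simp))
      exact ⟨s * b i, by rw [hs, hπ, smul_smul]⟩
  choose s hs using hs
  have hsinj : ∀ i, Function.Injective (s i) := fun i c c' h =>
    smul_left_injective F (hune i) (p.injective (by
      change p (c • u i) = p (c' • u i)
      rw [hs, hs, h]))
  have hs0 : ∀ i, s i 0 = 0 := fun i => by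
    have h1 := hs i 0
    rw [zero_smul, hp0, eq_comm, smul_eq_zero] at h1
    exact h1.resolve_right (hune _)
  let sq : F ≃ F := Equiv.ofBijective (fun x => x ^ 2) (bijective_frobenius F 2)
  have hsq : ∀ x, sq x = x ^ 2 := fun _ => rfl
  have hsq' : ∀ x, sq.symm x ^ 2 = x := fun x => sq.apply_symm_apply x
  have hsq0 : sq.symm 0 = 0 := by rw [Equiv.symm_apply_eq, hsq]; simp
  let ρ : Equiv.Perm ι := Equiv.ofBijective π (Finite.injective_iff_bijective.1 hπinj)
  have hρ : ∀ i, ρ i = π i := fun _ => rfl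
  let σ : ι → Equiv.Perm F := fun i =>
    (sq.symm.trans (Equiv.ofBijective (s i) (Finite.injective_iff_bijective.1 (hsinj i)))).trans sq
  have hσ : ∀ i x, σ i x = s i (sq.symm x) ^ 2 := fun _ _ => rfl
  let f : Equiv.Perm (ι → F) := ρ.piCongr σ
  have hf : ∀ v i, f v (ρ i) = σ i (v i) := fun v i => Equiv.piCongr_apply_apply _ _ _ _
  have hfM : ∀ c ∈ dualCode (conicCode u), f c ∈ dualCode (conicCode u) := by
    intro c hc
    rw [mem_dualCode_conicCode] at hc ⊢
    -- the word `c` is represented by one vector on each line where it does not vanish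
    set r : ι → Fin 2 → F := fun i => sq.symm (c i) • u i with hr
    have hr0 : ∀ i, c i ≠ 0 → sq.symm (c i) ≠ 0 := fun i hi h0 => hi (by
      rw [← hsq' (c i), h0]; simp)
    have hinj : Set.InjOn r (Finset.univ.filter fun i => c i ≠ 0) := by
      intro i hi j _ hij
      exact (hu.smul_inj (hr0 i (by simpa using hi)) hij).1
    have hrel := hp ((Finset.univ.filter fun i => c i ≠ 0).image r) (by
      intro a
      refine Eq.trans ?_ (hc a)
      rw [Finset.sum_image hinj]
      simp only [hr, quadForm_smul, hsq']
      rw [Finset.sum_filter_of_ne]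
      intro i _ h h0
      rw [h0, zero_mul] at h
      exact h rfl)
    intro a
    rw [← hrel a, Finset.sum_image hinj, Finset.sum_filter_of_ne]
    · rw [← Equiv.sum_comp ρ]
      refine Finset.sum_congr rfl fun i _ => ?_
      rw [hf, hσ, hr, hs, quadForm_smul, hρ]
    · intro i _ h h0
      simp [hr, h0, hsq0, hp0] at h
  have hfstab : f ∈ setwiseStabilizer (dualCode (conicCode u) : Set (ι → F)) := by
    refine Set.eq_of_subset_of_ncard_le (Set.image_subset_iff.2 hfM) ?_ (Set.toFinite _)
    rw [Set.ncard_image_of_injective _ f.injective]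
  have hf0 : f ∈ codeAut0 (dualCode (conicCode u) : Set (ι → F)) := by
    refine ⟨⟨mem_graphAut_of_perm ρ σ hf, hfstab⟩, ?_⟩
    ext i
    obtain ⟨i, rfl⟩ := ρ.surjective i
    rw [hf, hσ]
    simp [hsq0, hs0]
  have hfS := coordInv_conj_mem_codeAutS (hM hf0)
  rw [dualCode_dualCode] at hfS
  obtain ⟨⟨τ, π', d, h⟩, hC⟩ := hfS
  obtain ⟨g, -, hg⟩ := hu.exists_action_eq h hC
  refine ⟨g, ?_⟩
  ext1 v
  obtain ⟨j, c, rfl⟩ := hu.exists_smul v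
  by_cases hc : c = 0
  · have hg0 : g.1.1 0 = 0 := by simpa using g.2.2 0 0
    rw [hc, zero_smul, hg0, hp0]
  obtain ⟨i, a, hga⟩ := hu.exists_smul (g.1.1 (u j))
  have ha : a ≠ 0 := by
    rintro rfl
    have hg0 : g.1.1 0 = 0 := by simpa using g.2.2 0 0
    rw [zero_smul, ← hg0] at hga
    exact hune j (g.1.1.injective hga)
  obtain ⟨k, rfl⟩ := ρ.surjective i
  -- compare the two descriptions of the transform on a word of weight one
  have key := hu.action_apply_of_smul hga (Pi.single j (c ^ 2)⁻¹)
  rw [hg] at key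
  simp only [Equiv.Perm.mul_apply, coordInv_inv, coordInv_apply, Pi.inv_apply, hf,
    Pi.single_eq_same, map_inv₀, map_pow] at key
  have hkj : k = j := by
    by_contra hkj
    rw [Pi.single_eq_of_ne hkj, inv_zero, hσ, hsq0, hs0, eq_comm] at key
    simp [ha, hc] at key
  subst hkj
  have hcs : sq.symm (c ^ 2) = c := sq.symm_apply_apply c
  rw [Pi.single_eq_same, inv_inv, hσ, hcs, ← mul_inv, inv_inj, ← mul_pow] at key
  have key' : s k c = a * g.1.2 c := frobenius_inj F 2 key
  rw [g.2.2, hga, hs, key', smul_smul, hρ, mul_comm]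

/-- The binary code on the nonzero vectors of `F²`, indexed by `J`, whose words are the sets of
vectors on which all quadratic forms sum to zero. -/
def kasamiModel [Fintype J] [Algebra (ZMod 2) F] (w : J → Fin 2 → F) :
    Submodule (ZMod 2) (J → ZMod 2) where
  carrier := {c | ∀ a, ∑ j, algebraMap (ZMod 2) F (c j) * quadForm a (w j) = 0}
  zero_mem' := by simp
  add_mem' := by
    intro c c' h h' a
    simp [add_mul, Finset.sum_add_distrib, h a, h' a]
  smul_mem' := by
    intro r c h a
    simp [mul_assoc, ← Finset.mul_sum, h a]

theorem mem_kasamiModel [Fintype J] [Algebra (ZMod 2) F] {w : J → Fin 2 → F} {c : J → ZMod 2} :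
    c ∈ kasamiModel w ↔ ∀ a, ∑ j, algebraMap (ZMod 2) F (c j) * quadForm a (w j) = 0 := Iff.rfl

/-- The permutation of the nonzero vectors induced by a semilinear map. -/
def indexPerm (w : J ≃ {v : Fin 2 → F // v ≠ 0}) (p : semilinearPairs F) : Equiv.Perm J :=
  w.trans ((p.1.1.subtypePerm fun v => by
    have h0 : p.1.1 0 = 0 := by simpa using p.2.2 0 0
    rw [not_iff_not]
    exact ⟨fun h => p.1.1.injective (h.trans h0.symm), fun h => by rw [h, h0]⟩).trans w.symm)

theorem apply_indexPerm (w : J ≃ {v : Fin 2 → F // v ≠ 0}) (p : semilinearPairs F) (j : J) :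
    (w (indexPerm w p j) : Fin 2 → F) = p.1.1 (w j) := by
  simp [indexPerm]

theorem eq_indexPerm {w : J ≃ {v : Fin 2 → F // v ≠ 0}} {p : semilinearPairs F} {j k : J}
    (h : (w k : Fin 2 → F) = p.1.1 (w j)) : indexPerm w p j = k :=
  w.injective (Subtype.ext ((apply_indexPerm w p j).trans h.symm))

/-- The action of the semilinear maps on the binary words by permutation of the coordinates. -/
def kasamiAction (w : J ≃ {v : Fin 2 → F // v ≠ 0}) :
    semilinearPairs F →* Equiv.Perm (J → ZMod 2) where
  toFun p := Equiv.arrowCongr (indexPerm w p) (Equiv.refl _)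
  map_one' := by
    have : indexPerm w 1 = 1 := Equiv.ext fun j => eq_indexPerm rfl
    rw [this]
    rfl
  map_mul' p p' := by
    have : indexPerm w (p * p') = indexPerm w p * indexPerm w p' := Equiv.ext fun j =>
      eq_indexPerm (by rw [Equiv.Perm.mul_apply, apply_indexPerm, apply_indexPerm]; rfl)
    rw [this]
    rfl

theorem kasamiAction_apply (w : J ≃ {v : Fin 2 → F // v ≠ 0}) (p : semilinearPairs F)
    (c : J → ZMod 2) (j : J) : kasamiAction w p c j = c ((indexPerm w p).symm j) := rfl

theorem kasamiAction_injective (w : J ≃ {v : Fin 2 → F // v ≠ 0}) :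
    Function.Injective (kasamiAction w) := by
  classical
  rw [injective_iff_map_eq_one]
  intro p hp
  refine semilinearPairs_ext (Equiv.ext fun v => ?_)
  by_cases hv : v = 0
  · subst hv
    simpa using p.2.2 0 0
  · obtain ⟨j, hj⟩ := w.surjective ⟨v, hv⟩
    have h1 : kasamiAction w p (Pi.single j 1) (indexPerm w p j) =
        (Pi.single j 1 : J → ZMod 2) (indexPerm w p j) := by rw [hp]; rfl
    rw [kasamiAction_apply, Equiv.symm_apply_apply, Pi.single_eq_same] at h1
    have h2 : indexPerm w p j = j := by
      by_contra hne
      rw [Pi.single_eq_of_ne hne] at h1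
      exact one_ne_zero h1
    have h3 := apply_indexPerm w p j
    rw [h2, hj] at h3
    exact h3.symm

theorem kasamiAction_mem_kasamiModel [Fintype J] [Algebra (ZMod 2) F]
    (w : J ≃ {v : Fin 2 → F // v ≠ 0}) (p : semilinearPairs F) {c : J → ZMod 2}
    (hc : c ∈ kasamiModel fun j => (w j : Fin 2 → F)) :
    kasamiAction w p c ∈ kasamiModel fun j => (w j : Fin 2 → F) := by
  intro a
  obtain ⟨a', ha'⟩ := exists_quadForm_comp p.2 a
  have hτ : ∀ x : ZMod 2, p.1.2 (algebraMap (ZMod 2) F x) = algebraMap (ZMod 2) F x := fun x =>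
    congrArg (fun φ : ZMod 2 →+* F => φ x)
      (Subsingleton.elim ((p.1.2 : F →+* F).comp (algebraMap (ZMod 2) F)) (algebraMap (ZMod 2) F))
  rw [← Equiv.sum_comp (indexPerm w p)]
  simp only [kasamiAction_apply, Equiv.symm_apply_apply, apply_indexPerm, ha']
  rw [← map_zero p.1.2, ← hc a', map_sum]
  simp only [map_mul, hτ]

theorem kasamiAction_mem_codeAutS [Fintype J] [Algebra (ZMod 2) F]
    (w : J ≃ {v : Fin 2 → F // v ≠ 0}) (p : semilinearPairs F) :
    kasamiAction w p ∈
      codeAutS (kasamiModel (fun j => (w j : Fin 2 → F)) : Set (J → ZMod 2)) := by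
  refine ⟨⟨RingEquiv.refl _, indexPerm w p, 1, fun v i => by simp [kasamiAction_apply]⟩,
    mem_setwiseStabilizer_of_forall (fun c hc => kasamiAction_mem_kasamiModel w p hc)
      fun c hc => ?_⟩
  rw [← map_inv]
  exact kasamiAction_mem_kasamiModel w p⁻¹ hc

/-- A coordinate permutation preserving the Kasami code preserves the relations among quadratic
forms. -/
theorem preservesRelations_of_kasamiModel [Fintype J] [Finite F] [Algebra (ZMod 2) F]
    (w : J ≃ {v : Fin 2 → F // v ≠ 0}) {π : Equiv.Perm J} {p : Equiv.Perm (Fin 2 → F)}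
    (hp0 : p 0 = 0) (hp : ∀ j, p (w j) = w (π j))
    (h : ∀ c ∈ kasamiModel fun j => (w j : Fin 2 → F),
      (fun j => c (π.symm j)) ∈ kasamiModel fun j => (w j : Fin 2 → F)) :
    PreservesRelations p := by
  classical
  have := Fintype.ofFinite F
  intro A hA
  have hsum : ∀ φ : (Fin 2 → F) → F, φ 0 = 0 →
      ∑ j, algebraMap (ZMod 2) F (if (w j : Fin 2 → F) ∈ A then 1 else 0) * φ (w j) =
        ∑ v ∈ A, φ v := by
    intro φ h0
    have h1 : ∀ v, algebraMap (ZMod 2) F (if v ∈ A then 1 else 0) * φ v =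
        if v ∈ A then φ v else 0 := fun v => by split_ifs <;> simp
    simp only [h1]
    rw [Equiv.sum_comp w fun v => if (v : Fin 2 → F) ∈ A then φ v else 0,
      ← Finset.sum_subtype (Finset.univ.filter fun v : Fin 2 → F => v ≠ 0) (by simp)
        fun v => if v ∈ A then φ v else 0, Finset.sum_filter_of_ne, Finset.sum_ite_mem,
      Finset.univ_inter]
    rintro v - hv rfl
    simp [h0] at hv
  have h1 := h (fun j => if (w j : Fin 2 → F) ∈ A then 1 else 0) fun a => by
    rw [hsum _ (quadForm_zero a), hA]
  intro a
  have h2 := h1 a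
  rw [← Equiv.sum_comp π] at h2
  simp only [Equiv.symm_apply_apply, ← hp] at h2
  rw [← hsum (fun v => quadForm a (p v)) (by rw [hp0, quadForm_zero]), h2]

theorem nonempty_codeAutS_kasamiModel_mulEquiv [Fintype ι] [Fintype J] [Finite F] [DecidableEq F]
    [CharP F 2] [Algebra (ZMod 2) F] {u : ι → Fin 2 → F} (hu : IsProjectiveFrame u)
    (hM : codeAut0 (dualCode (conicCode u) : Set (ι → F)) ≤
      codeAutS (dualCode (conicCode u) : Set (ι → F)))
    (w : J ≃ {v : Fin 2 → F // v ≠ 0}) :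
    Nonempty (codeAutS (kasamiModel (fun j => (w j : Fin 2 → F)) : Set (J → ZMod 2)) ≃*
      generalSemilinearGroup 2 F) := by
  obtain ⟨e⟩ := nonempty_semilinearPairs_mulEquiv (F := F)
  refine nonempty_mulEquiv_of_range_eq (kasamiAction w) (kasamiAction_injective w)
    (fun f => ⟨?_, ?_⟩) e
  · rintro ⟨⟨τ, π, d, h⟩, hC⟩
    have hτ : ∀ (x : ZMod 2) (d : (ZMod 2)ˣ), τ (d * x) = x := by
      intro x d
      have hx : ∀ x : ZMod 2, x = 0 ∨ x = 1 := by decide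
      rcases hx x with rfl | rfl
      · simp
      · rcases hx d with hd | hd
        · exact absurd hd d.ne_zero
        · simp [hd]
    have h' : ∀ v j, f v j = v (π.symm j) := fun v j => by rw [h, hτ]
    classical
    set p : Equiv.Perm (Fin 2 → F) := Equiv.Perm.ofSubtype ((w.symm.trans π).trans w) with hpdef
    have hp0 : p 0 = 0 := Equiv.Perm.ofSubtype_apply_of_not_mem _ (by simp)
    have hp : ∀ j, p (w j) = w (π j) := fun j => by
      rw [hpdef, Equiv.Perm.ofSubtype_apply_coe]
      simp
    have hp1 : PreservesRelations p := by
      refine preservesRelations_of_kasamiModel w hp0 hp fun c hc => ?_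
      rw [← funext (h' c)]
      exact map_mem_of_mem_setwiseStabilizer hC hc
    have hp2 : PreservesRelations p.symm := by
      refine preservesRelations_of_kasamiModel w (π := π.symm)
        (by rw [Equiv.symm_apply_eq, hp0]) (fun j => ?_) fun c hc => ?_
      · rw [Equiv.symm_apply_eq, hp, Equiv.apply_symm_apply]
      · have h1 : (fun j => c (π.symm.symm j)) = f⁻¹ c := by
          rw [Equiv.Perm.eq_inv_iff_eq]
          funext j
          rw [h']
          simp
        rw [h1]
        exact map_mem_of_mem_setwiseStabilizer (inv_mem hC) hc
    obtain ⟨g, hg⟩ := PreservesRelations.exists_semilinearPair hu hM hp0 hp1 hp2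
    have hind : indexPerm w g = π := Equiv.ext fun j => eq_indexPerm (by rw [hg, hp])
    refine ⟨g, ?_⟩
    ext v j
    rw [kasamiAction_apply, hind, h']
  · rintro ⟨p, rfl⟩
    exact kasamiAction_mem_codeAutS w p

end Kasami

/-! ### The cyclic codes in coordinates -/

section CyclicCodes

variable {F E : Type*} [Field F] [Field E] [Algebra F E] {q : ℕ}

theorem sum_pow_two_pow [CharP E 2] {m : ℕ} (hq : q = 2 ^ m) {κ : Type*} [Fintype κ]
    (g : κ → E) : (∑ i, g i) ^ q = ∑ i, g i ^ q := by
  rw [hq]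
  exact sum_pow_char_pow 2 m Finset.univ g

theorem eval_wordPoly {n : ℕ} {k : Type*} [Field k] [Algebra k E] (c : Fin n → k) (z : E) :
    (wordPoly E c).eval z = ∑ i, algebraMap k E (c i) * z ^ (i : ℕ) := by
  simp [wordPoly, eval_finsetSum]

theorem sum_fin_pow_eq_zero {n : ℕ} {x : E}
    (hx : x ^ n = 1) (hx1 : x ≠ 1) : ∑ i : Fin n, x ^ (i : ℕ) = 0 := by
  rw [Fin.sum_univ_eq_sum_range (fun i => x ^ i) n, geom_sum_eq hx1, hx, sub_self, zero_div]

theorem X_pow_sub_one_dvd_iff {ζ : E} {n : ℕ} (hn : 0 < n) (hζ : IsPrimitiveRoot ζ n) (g : E[X]) :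
    (X ^ n - 1 : E[X]) ∣ g ↔ ∀ j < n, g.eval (ζ ^ j) = 0 := by
  constructor
  · rintro ⟨h, rfl⟩ j -
    have h1 : (ζ ^ j) ^ n = 1 := by rw [← pow_mul, mul_comm, pow_mul, hζ.pow_eq_one, one_pow]
    simp [h1]
  · intro h
    have : NeZero n := ⟨hn.ne'⟩
    rw [X_pow_sub_one_eq_prod hn hζ]
    refine Finset.prod_dvd_of_coprime
      (fun x _ y _ hxy => pairwise_coprime_X_sub_C Function.injective_id hxy) fun x hx => ?_
    rw [mem_nthRootsFinset hn] at hx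
    obtain ⟨j, hj, rfl⟩ := hζ.eq_pow_of_pow_eq_one hx
    exact dvd_iff_isRoot.2 (h j hj)

/-- The words `e₀ + e₁ ζ ^ i + e₂ ζ ^ (q i)` belong to the cyclic code. -/
theorem mem_cyclicCode_of_eq {ζ : E} (hζ : IsPrimitiveRoot ζ (q + 1))
    {c : Fin (q + 1) → F} {e₀ e₁ e₂ : E} (hq1 : 1 ≤ q)
    (hc : ∀ i, algebraMap F E (c i) = e₀ + e₁ * ζ ^ (i : ℕ) + e₂ * (ζ ^ q) ^ (i : ℕ)) :
    c ∈ cyclicCodeOfCheck (q + 1) F ((X - 1) * (X - C ζ) * (X - C (ζ ^ q)) : E[X]) := by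
  refine (X_pow_sub_one_dvd_iff (by omega) hζ _).2 fun j hj => ?_
  by_cases hj0 : j = 0
  · simp [hj0]
  by_cases hj1 : j = 1
  · simp [hj1]
  by_cases hjq : j = q
  · simp [hjq]
  have hpow : ∀ x : ℕ, (ζ ^ x) ^ (q + 1) = 1 := fun x => by
    rw [← pow_mul, mul_comm, pow_mul, hζ.pow_eq_one, one_pow]
  have hne : ∀ x : ℕ, ¬ (q + 1) ∣ x → ζ ^ x ≠ 1 := fun x hx h =>
    hx (hζ.dvd_of_pow_eq_one x h)
  have hndvd : ∀ x, 0 < x → x < 2 * (q + 1) → x ≠ q + 1 → ¬ (q + 1) ∣ x := by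
    rintro x h0 h2 h1 ⟨k, rfl⟩
    have hk : k < 2 := by
      by_contra hk
      have := Nat.mul_le_mul_left (q + 1) (not_lt.1 hk)
      omega
    interval_cases k <;> omega
  have h0 := sum_fin_pow_eq_zero (hpow j) (hne _ (hndvd j (by omega) (by omega) (by omega)))
  have h1 := sum_fin_pow_eq_zero (hpow (1 + j))
    (hne _ (hndvd (1 + j) (by omega) (by omega) (by omega)))
  have h2 := sum_fin_pow_eq_zero (hpow (q + j))
    (hne _ (hndvd (q + j) (by omega) (by omega) (by omega)))
  rw [eval_mul, eval_wordPoly]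
  have : ∑ i, algebraMap F E (c i) * (ζ ^ j) ^ (i : ℕ) =
      e₀ * ∑ i : Fin (q + 1), (ζ ^ j) ^ (i : ℕ) +
      e₁ * ∑ i : Fin (q + 1), (ζ ^ (1 + j)) ^ (i : ℕ) +
      e₂ * ∑ i : Fin (q + 1), (ζ ^ (q + j)) ^ (i : ℕ) := by
    simp only [Finset.mul_sum, ← Finset.sum_add_distrib]
    refine Finset.sum_congr rfl fun i _ => ?_
    rw [hc, pow_add, pow_add, mul_pow, mul_pow, pow_one]
    ring
  rw [this, h0, h1, h2]
  ring

end CyclicCodes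

section Translation

variable {F E : Type*} [Field F] [Field E] [Algebra F E] [Fintype F] {q : ℕ}

theorem algebraMap_pow_card (hF : Fintype.card F = q) (x : F) :
    algebraMap F E x ^ q = algebraMap F E x := by
  rw [← map_pow, ← hF, FiniteField.pow_card]

theorem exists_algebraMap_eq_of_pow_eq (hF : Fintype.card F = q) {x : E} (hx : x ^ q = x) :
    ∃ c : F, algebraMap F E c = x := by
  classical
  have hq : 1 < q := hF ▸ Fintype.one_lt_card
  have hp : (X ^ q - X : E[X]) ≠ 0 := FiniteField.X_pow_card_sub_X_ne_zero E hq
  have hdeg : (X ^ q - X : E[X]).natDegree = q := FiniteField.X_pow_card_sub_X_natDegree_eq E hq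
  have hroot : ∀ y : E, y ∈ (X ^ q - X : E[X]).roots.toFinset ↔ y ^ q = y := fun y => by
    rw [Multiset.mem_toFinset, mem_roots hp]
    simp [sub_eq_zero]
  have hsub : Finset.univ.image (algebraMap F E) ⊆ (X ^ q - X : E[X]).roots.toFinset := by
    intro y hy
    obtain ⟨c, -, rfl⟩ := Finset.mem_image.1 hy
    rw [hroot, algebraMap_pow_card hF]
  have heq := Finset.eq_of_subset_of_card_le hsub (by
    rw [Finset.card_image_of_injective _ (algebraMap F E).injective, Finset.card_univ, hF]
    exact (Multiset.toFinset_card_le _).trans ((card_roots' _).trans hdeg.le))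
  have := (hroot x).2 hx
  rw [← heq] at this
  obtain ⟨c, -, hc⟩ := Finset.mem_image.1 this
  exact ⟨c, hc⟩

/-- In coordinates with respect to an `F`-basis of `E`, the functions `v ↦ v ^ 2` and the norm
`v ↦ v ^ (q + 1)` span the quadratic forms. -/
theorem sum_sq_norm_eq_zero_iff [CharP F 2] [CharP E 2] {m : ℕ} (hq : q = 2 ^ m)
    (hF : Fintype.card F = q) (b : E ≃ₗ[F] (Fin 2 → F)) {κ : Type*} [Fintype κ] (c : κ → F)
    (v : κ → E) :
    (∑ k, algebraMap F E (c k) * v k ^ 2 = 0 ∧ ∑ k, algebraMap F E (c k) * v k ^ (q + 1) = 0) ↔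
      ∀ a, ∑ k, c k * quadForm a (b (v k)) = 0 := by
  set φ := algebraMap F E with hφ
  have h2 : (2 : E) = 0 := CharTwo.two_eq_zero
  set e := b.symm ![1, 0] with he
  set f := b.symm ![0, 1] with hf
  have hv : ∀ x, x = φ (b x 0) * e + φ (b x 1) * f := by
    intro x
    rw [hφ, ← Algebra.smul_def, ← Algebra.smul_def, he, hf, ← map_smul, ← map_smul, ← map_add,
      LinearEquiv.eq_symm_apply]
    ext i
    fin_cases i <;> simp
  have hindep : ∀ x y : F, φ x * e + φ y * f = 0 → x = 0 ∧ y = 0 := by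
    intro x y h
    rw [hφ, ← Algebra.smul_def, ← Algebra.smul_def, he, hf, ← map_smul, ← map_smul, ← map_add,
      LinearEquiv.map_eq_zero_iff] at h
    have h0 := congrFun h 0
    have h1 := congrFun h 1
    simp at h0 h1
    exact ⟨h0, h1⟩
  have hadd : ∀ x y : E, (x + y) ^ q = x ^ q + y ^ q := fun x y => by
    rw [hq]; exact add_pow_char_pow x y 2 m
  set t := e * f ^ q + f * e ^ q with ht
  have hsq : ∀ x, x ^ 2 = φ (b x 0 ^ 2) * e ^ 2 + φ (b x 1 ^ 2) * f ^ 2 := by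
    intro x
    conv_lhs => rw [hv x]
    rw [map_pow, map_pow]
    linear_combination φ (b x 0) * φ (b x 1) * e * f * h2
  have hnorm : ∀ x, x ^ (q + 1) = φ (b x 0 ^ 2) * e ^ (q + 1) + φ (b x 0 * b x 1) * t +
      φ (b x 1 ^ 2) * f ^ (q + 1) := by
    intro x
    have h1 : x ^ q = φ (b x 0) * e ^ q + φ (b x 1) * f ^ q := by
      conv_lhs => rw [hv x]
      rw [hadd, mul_pow, mul_pow, algebraMap_pow_card hF, algebraMap_pow_card hF]
    rw [pow_succ, h1]
    conv_lhs => rw [hv x]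
    simp only [map_pow, map_mul, ht]
    have h3 : b (φ (b x 0) * e + φ (b x 1) * f) = b x := by rw [← hv x]
    rw [h3]
    ring
  have ht0 : t ≠ 0 := by
    intro h0
    have he0 : e ≠ 0 := fun h => by
      have := hindep 1 0 (by rw [h]; simp)
      exact one_ne_zero this.1
    have h1 : (f / e) ^ q = f / e := by
      rw [div_pow, div_eq_div_iff (pow_ne_zero _ he0) he0]
      linear_combination h0 - f * e ^ q * h2
    obtain ⟨c, hc⟩ := exists_algebraMap_eq_of_pow_eq hF h1
    have := hindep c 1 (by
      rw [hφ, hc, div_mul_cancel₀ _ he0, map_one, one_mul, ← two_mul, h2, zero_mul])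
    exact one_ne_zero this.2
  -- the three coordinate sums
  set x := ∑ k, c k * b (v k) 0 ^ 2 with hx
  set y := ∑ k, c k * (b (v k) 0 * b (v k) 1) with hy
  set z := ∑ k, c k * b (v k) 1 ^ 2 with hz
  have hS : ∑ k, φ (c k) * v k ^ 2 = φ x * e ^ 2 + φ z * f ^ 2 := by
    rw [hx, hz, map_sum, map_sum, Finset.sum_mul, Finset.sum_mul, ← Finset.sum_add_distrib]
    refine Finset.sum_congr rfl fun k _ => ?_
    rw [hsq (v k), map_mul, map_mul]
    ring
  have hN : ∑ k, φ (c k) * v k ^ (q + 1) = φ x * e ^ (q + 1) + φ y * t + φ z * f ^ (q + 1) := by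
    rw [hx, hy, hz, map_sum, map_sum, map_sum, Finset.sum_mul, Finset.sum_mul, Finset.sum_mul,
      ← Finset.sum_add_distrib, ← Finset.sum_add_distrib]
    refine Finset.sum_congr rfl fun k _ => ?_
    rw [hnorm (v k)]
    simp only [map_mul]
    ring
  have hQ : ∀ a, ∑ k, c k * quadForm a (b (v k)) = a 0 * x + a 1 * y + a 2 * z := by
    intro a
    rw [hx, hy, hz, Finset.mul_sum, Finset.mul_sum, Finset.mul_sum, ← Finset.sum_add_distrib,
      ← Finset.sum_add_distrib]
    refine Finset.sum_congr rfl fun k _ => ?_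
    rw [quadForm]
    ring
  rw [hS, hN]
  constructor
  · rintro ⟨h1, h3⟩ a
    obtain ⟨x', hx'⟩ := (bijective_frobenius F 2).2 x
    obtain ⟨z', hz'⟩ := (bijective_frobenius F 2).2 z
    rw [frobenius_def] at hx' hz'
    have h4 : (φ x' * e + φ z' * f) ^ 2 = 0 := by
      rw [← hx', ← hz', map_pow, map_pow] at h1
      linear_combination h1 + φ x' * φ z' * e * f * h2
    obtain ⟨hx0, hz0⟩ := hindep _ _ (pow_eq_zero_iff two_ne_zero |>.1 h4)
    have hx1 : x = 0 := by rw [← hx', hx0]; simp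
    have hz1 : z = 0 := by rw [← hz', hz0]; simp
    rw [hx1, hz1, map_zero, zero_mul, zero_mul, zero_add, add_zero, mul_eq_zero,
      or_iff_left ht0] at h3
    have hy1 : y = 0 := (map_eq_zero φ).1 h3
    rw [hQ, hx1, hy1, hz1]
    ring
  · intro h
    have hx1 : x = 0 := by simpa using (hQ ![1, 0, 0]).symm.trans (h _)
    have hy1 : y = 0 := by simpa using (hQ ![0, 1, 0]).symm.trans (h _)
    have hz1 : z = 0 := by simpa using (hQ ![0, 0, 1]).symm.trans (h _)
    rw [hx1, hy1, hz1]
    simp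

/-- The nonzero elements of `E`, written as powers of a primitive element, in coordinates. -/
noncomputable def powerEquiv {N : ℕ} [NeZero N] [Finite E] {α : E} (hα : IsPrimitiveRoot α N)
    (hN : N = Nat.card E - 1) (b : E ≃ₗ[F] (Fin 2 → F)) : Fin N ≃ {v : Fin 2 → F // v ≠ 0} :=
  Equiv.ofBijective
    (fun i => ⟨b (α ^ (i : ℕ)), by
      rw [Ne, LinearEquiv.map_eq_zero_iff]
      exact pow_ne_zero _ (hα.ne_zero (NeZero.ne N))⟩) (by
    have := Fintype.ofFinite E
    constructor
    · intro i j hij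
      have h1 : b (α ^ (i : ℕ)) = b (α ^ (j : ℕ)) := congrArg Subtype.val hij
      exact Fin.ext (hα.pow_inj i.2 j.2 (b.injective h1))
    · rintro ⟨v, hv⟩
      have h1 : b.symm v ≠ 0 := by simpa using hv
      have h2 : b.symm v ^ N = 1 := by
        rw [hN, Nat.card_eq_fintype_card, FiniteField.pow_card_sub_one_eq_one _ h1]
      obtain ⟨i, hi, h3⟩ := hα.eq_pow_of_pow_eq_one h2
      refine ⟨⟨i, hi⟩, Subtype.ext ?_⟩
      simp [h3])

theorem codeK_eq_kasamiModel [CharP F 2] [CharP E 2] [Algebra (ZMod 2) F] [Algebra (ZMod 2) E]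
    {m : ℕ} (hq : q = 2 ^ m) (hF : Fintype.card F = q) (α : E) (b : E ≃ₗ[F] (Fin 2 → F)) :
    codeK q α = kasamiModel fun j : Fin (q ^ 2 - 1) => b (α ^ (j : ℕ)) := by
  ext c
  have halg : ∀ x : ZMod 2, algebraMap F E (algebraMap (ZMod 2) F x) = algebraMap (ZMod 2) E x :=
    fun x => congrArg (fun φ : ZMod 2 →+* E => φ x)
      (Subsingleton.elim ((algebraMap F E).comp (algebraMap (ZMod 2) F)) (algebraMap (ZMod 2) E))
  have hsq : ∀ x : ZMod 2, algebraMap (ZMod 2) E x = algebraMap (ZMod 2) E x ^ 2 := fun x => by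
    rw [← map_pow]
    congr 1
    revert x
    decide
  rw [mem_kasamiModel, ← sum_sq_norm_eq_zero_iff hq hF b]
  simp only [halg]
  have h1 : ∑ k : Fin (q ^ 2 - 1), algebraMap (ZMod 2) E (c k) * (α ^ (k : ℕ)) ^ 2 =
      (∑ k : Fin (q ^ 2 - 1), algebraMap (ZMod 2) E (c k) * α ^ (k : ℕ)) ^ 2 := by
    rw [sum_pow_char]
    refine Finset.sum_congr rfl fun k _ => ?_
    rw [mul_pow, ← hsq]
  have h2 : ∑ k : Fin (q ^ 2 - 1), algebraMap (ZMod 2) E (c k) * (α ^ (k : ℕ)) ^ (q + 1) =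
      ∑ k : Fin (q ^ 2 - 1), algebraMap (ZMod 2) E (c k) * (α ^ (1 + q)) ^ (k : ℕ) := by
    refine Finset.sum_congr rfl fun k _ => ?_
    rw [← pow_mul, ← pow_mul]
    ring
  rw [h1, h2, pow_eq_zero_iff two_ne_zero]
  change (∀ z ∈ ({α, α ^ (1 + q)} : Set E), (wordPoly E c).eval z = 0) ↔ _
  simp only [Set.mem_insert_iff, Set.mem_singleton_iff, forall_eq_or_imp, forall_eq,
    eval_wordPoly]

/-- The elements of norm one represent the points of the projective line of `E = F²`: every nonzero
element of `E` has a norm in `F`, which is a square, and `1` is the only element of `F` with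
square `1`. -/
theorem isProjectiveFrame_pow [Finite E] [CharP F 2] (hF : Fintype.card F = q)
    (hE : Nat.card E = q ^ 2) {β : E} (hβ : IsPrimitiveRoot β (q + 1))
    (b : E ≃ₗ[F] (Fin 2 → F)) :
    IsProjectiveFrame fun i : Fin (q + 1) => b (β ^ (i : ℕ)) := by
  have := Fintype.ofFinite E
  have hβ0 : β ≠ 0 := hβ.ne_zero (by omega)
  have hone : ∀ i : ℕ, (β ^ i) ^ (q + 1) = 1 := fun i => by
    rw [← pow_mul, mul_comm, pow_mul, hβ.pow_eq_one, one_pow]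
  have hnormF : ∀ c : F, algebraMap F E c ^ (q + 1) = algebraMap F E (c ^ 2) := fun c => by
    rw [pow_succ, algebraMap_pow_card hF, map_pow, sq]
  constructor
  · intro i
    rw [Ne, LinearEquiv.map_eq_zero_iff]
    exact pow_ne_zero _ hβ0
  · intro v
    set x := b.symm v with hx
    by_cases hx0 : x = 0
    · refine ⟨0, 0, ?_⟩
      rw [zero_smul]
      simpa [hx] using hx0
    have hN : (x ^ (q + 1)) ^ q = x ^ (q + 1) := by
      have h1 : x ^ (q ^ 2) = x := by
        rw [← hE, Nat.card_eq_fintype_card, FiniteField.pow_card]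
      rw [← pow_mul, add_mul, pow_add, ← sq, h1, one_mul, pow_succ, mul_comm]
    obtain ⟨n, hn⟩ := exists_algebraMap_eq_of_pow_eq hF hN
    obtain ⟨c, rfl⟩ := (bijective_frobenius F 2).2 n
    rw [frobenius_def] at hn
    have hc0 : algebraMap F E c ≠ 0 := by
      intro h0
      rw [map_pow, h0, zero_pow two_ne_zero, eq_comm, pow_eq_zero_iff (by omega)] at hn
      exact hx0 hn
    obtain ⟨i, hi, h1⟩ := hβ.eq_pow_of_pow_eq_one (ξ := x / algebraMap F E c) (by
      rw [div_pow, hnormF, hn, div_self (pow_ne_zero _ hx0)])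
    refine ⟨⟨i, hi⟩, c, ?_⟩
    rw [← map_smul, ← LinearEquiv.symm_apply_eq, ← hx, Algebra.smul_def, h1,
      mul_div_cancel₀ _ hc0]
  · intro i j c h
    rw [← map_smul] at h
    have h1 : β ^ (i : ℕ) = algebraMap F E c * β ^ (j : ℕ) := by
      rw [← Algebra.smul_def]; exact b.injective h
    have h2 := congrArg (fun x => x ^ (q + 1)) h1
    simp only [mul_pow] at h2
    rw [hone, hone, hnormF, mul_one, ← map_one (algebraMap F E)] at h2
    have h3 : c = 1 := frobenius_inj F 2 (by
      simp only [frobenius_def, one_pow]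
      exact ((algebraMap F E).injective h2).symm)
    rw [h3, map_one, one_mul] at h1
    exact Fin.ext (hβ.pow_inj i.2 j.2 h1)

/-- A word `c` of the cyclic code is orthogonal to every word `w` whose polynomial vanishes at `1`
and `ζ`: the polynomials `P` of `c` and `W` of `w` satisfy `P(ζ ^ j) W(ζ ^ (-j)) = 0` for all `j`,
because `W` also vanishes at the conjugate `ζ ^ q = ζ⁻¹`; summing over `j` gives the inner product
by the orthogonality of the characters `i ↦ ζ ^ (i * j)`. -/
theorem dotProduct_eq_zero_of_mem_cyclicCode {ζ : E} (hζ : IsPrimitiveRoot ζ (q + 1))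
    [CharP E 2] {m : ℕ} (hm : 1 ≤ m) (hq : q = 2 ^ m)
    (hF : Fintype.card F = q) {c w : Fin (q + 1) → F}
    (hc : c ∈ cyclicCodeOfCheck (q + 1) F ((X - 1) * (X - C ζ) * (X - C (ζ ^ q)) : E[X]))
    (hw1 : ∑ i, algebraMap F E (w i) = 0) (hwζ : ∑ i, algebraMap F E (w i) * ζ ^ (i : ℕ) = 0) :
    dotProduct w c = 0 := by
  have hζ1 : ζ ^ (q + 1) = 1 := hζ.pow_eq_one
  -- the values of the polynomial of `w` at the conjugates
  have hconj : ∀ j : ℕ, ∑ i, algebraMap F E (w i) * (ζ ^ (q * j)) ^ (i : ℕ) =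
      (∑ i, algebraMap F E (w i) * (ζ ^ j) ^ (i : ℕ)) ^ q := by
    intro j
    rw [sum_pow_two_pow hq]
    refine Finset.sum_congr rfl fun i _ => ?_
    rw [mul_pow, algebraMap_pow_card hF, ← pow_mul, ← pow_mul, ← pow_mul]
    congr 2
    ring
  have hq0 : q ≠ 0 := by rw [hq]; positivity
  have hprod : ∀ j : Fin (q + 1),
      (∑ i, algebraMap F E (c i) * (ζ ^ (j : ℕ)) ^ (i : ℕ)) *
        (∑ i, algebraMap F E (w i) * (ζ ^ (q * j)) ^ (i : ℕ)) = 0 := by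
    intro j
    by_cases hj0 : (j : ℕ) = 0
    · rw [hj0, mul_zero, pow_zero]
      simp [hw1]
    by_cases hj1 : (j : ℕ) = 1
    · rw [hconj, hj1, pow_one, hwζ, zero_pow hq0, mul_zero]
    by_cases hjq : (j : ℕ) = q
    · rw [hconj, hjq]
      have h1 := hconj 1
      rw [mul_one, pow_one, hwζ, zero_pow hq0] at h1
      rw [h1, zero_pow hq0, mul_zero]
    have h1 := (X_pow_sub_one_dvd_iff (by omega) hζ _).1 hc j j.2
    rw [eval_mul, eval_wordPoly, mul_eq_zero] at h1
    rw [h1.resolve_right ?_, zero_mul]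
    have hinj : ∀ k < q + 1, (j : ℕ) ≠ k → ζ ^ (j : ℕ) ≠ ζ ^ k := fun k hk hjk h =>
      hjk (hζ.pow_inj j.2 hk h)
    have h2 := hinj 0 (by omega) hj0
    have h3 := hinj 1 (by omega) hj1
    have h4 := hinj q (by omega) hjq
    rw [pow_zero] at h2
    rw [pow_one] at h3
    simp [sub_eq_zero, h2, h3, h4]
  have htot : ∑ j : Fin (q + 1), (∑ i, algebraMap F E (c i) * (ζ ^ (j : ℕ)) ^ (i : ℕ)) *
        (∑ i, algebraMap F E (w i) * (ζ ^ (q * j)) ^ (i : ℕ)) =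
      algebraMap F E (dotProduct w c) := by
    have horth : ∀ i k : Fin (q + 1), ∑ j : Fin (q + 1), (ζ ^ ((i : ℕ) + q * k)) ^ (j : ℕ) =
        if i = k then 1 else 0 := by
      intro i k
      have hk : ζ ^ ((i : ℕ) + q * k) * ζ ^ (k : ℕ) = ζ ^ (i : ℕ) := by
        rw [← pow_add, add_assoc, ← add_one_mul, pow_add, pow_mul, hζ1, one_pow, mul_one]
      have hk0 : ζ ^ (k : ℕ) ≠ 0 := pow_ne_zero _ (hζ.ne_zero (by omega))
      split_ifs with hik
      · rw [hik] at hk ⊢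
        have h1 : ζ ^ ((k : ℕ) + q * k) = 1 := mul_right_cancel₀ hk0 (by rw [hk, one_mul])
        rw [h1]
        have h2 : (2 : E) = 0 := CharTwo.two_eq_zero
        have h3 : ((q : ℕ) : E) = 0 := by
          rw [hq, Nat.cast_pow, Nat.cast_ofNat, h2, zero_pow (by omega)]
        simp [h3]
      · refine sum_fin_pow_eq_zero ?_ fun h1 => hik ?_
        · rw [← pow_mul, mul_comm, pow_mul, hζ1, one_pow]
        · rw [h1, one_mul] at hk
          exact Fin.ext (hζ.pow_inj k.2 i.2 hk).symm
    have h1 : ∀ j : Fin (q + 1), (∑ i, algebraMap F E (c i) * (ζ ^ (j : ℕ)) ^ (i : ℕ)) *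
        (∑ i, algebraMap F E (w i) * (ζ ^ (q * j)) ^ (i : ℕ)) =
        ∑ i : Fin (q + 1), ∑ k : Fin (q + 1), algebraMap F E (c i) * algebraMap F E (w k) *
          (ζ ^ ((i : ℕ) + q * k)) ^ (j : ℕ) := by
      intro j
      rw [Finset.sum_mul_sum]
      refine Finset.sum_congr rfl fun i _ => Finset.sum_congr rfl fun k _ => ?_
      rw [mul_mul_mul_comm, ← pow_mul, ← pow_mul, ← pow_add, ← pow_mul]
      congr 2
      ring
    simp only [h1]
    rw [Finset.sum_comm, dotProduct, map_sum]
    refine Finset.sum_congr rfl fun i _ => ?_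
    rw [Finset.sum_comm]
    simp only [← Finset.mul_sum, horth]
    simp [mul_comm]
  rw [Finset.sum_eq_zero fun j _ => hprod j, eq_comm, map_eq_zero] at htot
  exact htot

theorem cyclicCode_eq_conicCode {ζ : E} (hζ : IsPrimitiveRoot ζ (q + 1))
    [Finite E] [CharP F 2] [CharP E 2] {m : ℕ} (hm : 1 ≤ m)
    (hq : q = 2 ^ m) (hF : Fintype.card F = q) (hE : Nat.card E = q ^ 2) {β : E}
    (hβ : β ^ 2 = ζ) (hβ1 : β ^ (q + 1) = 1) (b : E ≃ₗ[F] (Fin 2 → F)) :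
    cyclicCodeOfCheck (q + 1) F ((X - 1) * (X - C ζ) * (X - C (ζ ^ q)) : E[X]) =
      conicCode fun i : Fin (q + 1) => b (β ^ (i : ℕ)) := by
  have hq1 : 1 < q := hF ▸ Fintype.one_lt_card
  have hiff : ∀ w : Fin (q + 1) → F,
      w ∈ dualCode (conicCode fun i : Fin (q + 1) => b (β ^ (i : ℕ))) ↔
        ∑ i, algebraMap F E (w i) * ζ ^ (i : ℕ) = 0 ∧ ∑ i, algebraMap F E (w i) = 0 := by
    intro w
    rw [mem_dualCode_conicCode, ← sum_sq_norm_eq_zero_iff hq hF b]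
    have h1 : ∀ i : ℕ, (β ^ i) ^ 2 = ζ ^ i := fun i => by
      rw [← pow_mul, mul_comm, pow_mul, hβ]
    have h2 : ∀ i : ℕ, (β ^ i) ^ (q + 1) = 1 := fun i => by
      rw [← pow_mul, mul_comm, pow_mul, hβ1, one_pow]
    simp only [h1, h2, mul_one]
  rw [← dualCode_dualCode (cyclicCodeOfCheck _ _ _), ← dualCode_dualCode (conicCode _)]
  congr 1
  ext w
  rw [hiff]
  constructor
  · intro hw
    have hw' : ∀ c, c ∈ cyclicCodeOfCheck (q + 1) F
        ((X - 1) * (X - C ζ) * (X - C (ζ ^ q)) : E[X]) →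
        ∑ i, algebraMap F E (w i) * algebraMap F E (c i) = 0 := by
      intro c hc
      have h1 := congrArg (algebraMap F E) (hw c hc)
      rw [map_zero, dotProduct, map_sum] at h1
      simpa only [map_mul] using h1
    constructor
    · set S := ∑ i, algebraMap F E (w i) * ζ ^ (i : ℕ) with hS
      -- `S` is orthogonal to all elements of `E` under the trace form
      have htr : ∀ a : E, a * S + (a * S) ^ q = 0 := by
        intro a
        have h1 : ∀ i : ℕ, ∃ c : F, algebraMap F E c = a * ζ ^ i + (a * ζ ^ i) ^ q := by
          intro i
          refine exists_algebraMap_eq_of_pow_eq hF ?_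
          have h2 : (a * ζ ^ i) ^ (q ^ 2) = a * ζ ^ i := by
            have := Fintype.ofFinite E
            rw [← hE, Nat.card_eq_fintype_card, FiniteField.pow_card]
          have h3 : ∀ x y : E, (x + y) ^ q = x ^ q + y ^ q := fun x y => by
            rw [hq]; exact add_pow_char_pow x y 2 m
          rw [h3, ← pow_mul, ← sq, h2, add_comm]
        choose c hc using h1
        have h4 := hw' (fun i => c i) (mem_cyclicCode_of_eq hζ (e₀ := 0) (e₁ := a)
          (e₂ := a ^ q) hq1.le fun i => by
            rw [hc, mul_pow, zero_add, ← pow_mul, ← pow_mul, mul_comm q])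
        rw [← h4, hS, Finset.mul_sum]
        rw [sum_pow_two_pow hq, ← Finset.sum_add_distrib]
        refine Finset.sum_congr rfl fun i _ => ?_
        rw [hc, mul_pow, mul_pow, mul_pow, algebraMap_pow_card hF]
        ring
      by_contra hS0
      have hall : ∀ x : E, ∃ c : F, algebraMap F E c = x := by
        intro x
        refine exists_algebraMap_eq_of_pow_eq hF ?_
        have h1 := htr (x / S)
        rw [div_mul_cancel₀ _ hS0] at h1
        have h2 : (2 : E) = 0 := CharTwo.two_eq_zero
        linear_combination h1 - x * h2
      have h1 := Nat.card_le_card_of_surjective (algebraMap F E) hall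
      rw [hE, Nat.card_eq_fintype_card, hF] at h1
      nlinarith
    · have h1 := hw' (fun _ => 1) (mem_cyclicCode_of_eq hζ (e₀ := 1) (e₁ := 0) (e₂ := 0) hq1.le
        fun i => by simp)
      simpa using h1
  · rintro ⟨h1, h2⟩ c hc
    exact dotProduct_eq_zero_of_mem_cyclicCode hζ hm hq hF hc h2 h1

end Translation

theorem nonempty_codeAut_mulEquiv {ι F G : Type*} [Field F] [Fintype ι] [DecidableEq F]
    [Algebra (ZMod 2) F] [Group G] {C : Set (ι → F)} (h : codeAut0 C ≤ codeAutS C)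
    (e : Nonempty (codeAutS C ≃* G)) :
    Nonempty (codeAut0 C ≃* G) ∧ Nonempty (codeAutL (ZMod 2) C ≃* G) ∧
      Nonempty (codeAutS C ≃* G) := by
  obtain ⟨h1, h2⟩ := codeAut_groups_eq h
  rw [h1, h2]
  exact ⟨e, e, e⟩

theorem mainTheorem2 (m q : ℕ) (hm : 1 ≤ m) (hq : q = 2 ^ m)
    {F E : Type*} [Field F] [DecidableEq F] [Field E] [Algebra F E]
    [Algebra (ZMod 2) F] [Algebra (ZMod 2) E]
    (hF : Nat.card F = q) (hE : Nat.card E = q ^ 2)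
    (α : E) (hα : IsPrimitiveRoot α (q ^ 2 - 1)) :
    -- the code `M_q^⊥`
    (Nonempty (codeAut0 (codeMdual q F α : Set (Fin (q + 1) → F)) ≃* generalSemilinearGroup 2 F) ∧
      Nonempty (codeAutL (ZMod 2) (codeMdual q F α : Set (Fin (q + 1) → F)) ≃*
        generalSemilinearGroup 2 F) ∧
      Nonempty (codeAutS (codeMdual q F α : Set (Fin (q + 1) → F)) ≃*
        generalSemilinearGroup 2 F)) ∧
    -- the code `M_q`
    (Nonempty (codeAut0 (codeM q F α : Set (Fin (q + 1) → F)) ≃* generalSemilinearGroup 2 F) ∧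
      Nonempty (codeAutL (ZMod 2) (codeM q F α : Set (Fin (q + 1) → F)) ≃*
        generalSemilinearGroup 2 F) ∧
      Nonempty (codeAutS (codeM q F α : Set (Fin (q + 1) → F)) ≃*
        generalSemilinearGroup 2 F)) ∧
    -- the Kasami code `K_q`
    (Nonempty (codeAut0 (codeK q α : Set (Fin (q ^ 2 - 1) → ZMod 2)) ≃*
        generalSemilinearGroup 2 F) ∧
      Nonempty (codeAutL (ZMod 2) (codeK q α : Set (Fin (q ^ 2 - 1) → ZMod 2)) ≃*
        generalSemilinearGroup 2 F) ∧
      Nonempty (codeAutS (codeK q α : Set (Fin (q ^ 2 - 1) → ZMod 2)) ≃*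
        generalSemilinearGroup 2 F)) ∧
    -- the code `K_q^⊥`
    (Nonempty (codeAut0 (codeKdual q α : Set (Fin (q ^ 2 - 1) → ZMod 2)) ≃*
        generalSemilinearGroup 2 F) ∧
      Nonempty (codeAutL (ZMod 2) (codeKdual q α : Set (Fin (q ^ 2 - 1) → ZMod 2)) ≃*
        generalSemilinearGroup 2 F) ∧
      Nonempty (codeAutS (codeKdual q α : Set (Fin (q ^ 2 - 1) → ZMod 2)) ≃*
        generalSemilinearGroup 2 F)) ∧
    -- the monomial groups of `M_q^⊥` and `M_q`
    Nonempty (codeAutM (codeMdual q F α : Set (Fin (q + 1) → F)) ≃* GL (Fin 2) F) ∧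
    Nonempty (codeAutM (codeM q F α : Set (Fin (q + 1) → F)) ≃* GL (Fin 2) F) := by
  have hq2 : 2 ≤ q := by
    rw [hq]
    calc 2 = 2 ^ 1 := rfl
      _ ≤ 2 ^ m := Nat.pow_le_pow_right (by norm_num) hm
  have : Finite F := Nat.finite_of_card_ne_zero (by omega)
  have : Finite E := Nat.finite_of_card_ne_zero (by rw [hE]; positivity)
  have := Fintype.ofFinite F
  have := Fintype.ofFinite E
  have hF' : Fintype.card F = q := by rw [← Nat.card_eq_fintype_card, hF]
  have : CharP F 2 := charP_of_injective_algebraMap (algebraMap (ZMod 2) F).injective 2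
  have : CharP E 2 := charP_of_injective_algebraMap (algebraMap (ZMod 2) E).injective 2
  have hqq : q ^ 2 - 1 = (q - 1) * (q + 1) := by
    obtain ⟨k, rfl⟩ : ∃ k, q = k + 1 := ⟨q - 1, by omega⟩
    rw [Nat.add_sub_cancel, Nat.sub_eq_iff_eq_add (by nlinarith)]
    ring
  have hN : 0 < q ^ 2 - 1 := by rw [hqq]; exact Nat.mul_pos (by omega) (by omega)
  have : NeZero (q ^ 2 - 1) := ⟨hN.ne'⟩
  have hζ : IsPrimitiveRoot (α ^ (q - 1)) (q + 1) := hα.pow hN hqq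
  -- coordinates on the plane `E` over `F`
  have hfin : Module.finrank F E = 2 := by
    have h1 : Fintype.card E = Fintype.card F ^ Module.finrank F E := Module.card_eq_pow_finrank
    rw [← Nat.card_eq_fintype_card, hE, hF'] at h1
    exact (Nat.pow_right_injective hq2 h1).symm
  let b : E ≃ₗ[F] (Fin 2 → F) := (Module.finBasisOfFinrankEq F E hfin).equivFun
  -- the square root of `ζ` has norm one
  obtain ⟨β, hβ⟩ := (bijective_frobenius E 2).2 (α ^ (q - 1))
  rw [frobenius_def] at hβ
  have hβ1 : β ^ (q + 1) = 1 := frobenius_inj E 2 (by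
    simp only [frobenius_def]
    rw [← pow_mul, mul_comm, pow_mul, hβ, hζ.pow_eq_one, one_pow])
  have hβprim : IsPrimitiveRoot β (q + 1) :=
    ⟨hβ1, fun l hl => hζ.dvd_of_pow_eq_one l (by
      rw [← hβ, ← pow_mul, mul_comm, pow_mul, hl, one_pow])⟩
  have hu := isProjectiveFrame_pow hF' hE hβprim b
  have hMd : codeMdual q F α = conicCode fun i : Fin (q + 1) => b (β ^ (i : ℕ)) :=
    cyclicCode_eq_conicCode hζ hm hq hF' hE hβ hβ1 b
  have hM : codeM q F α = dualCode (conicCode fun i : Fin (q + 1) => b (β ^ (i : ℕ))) := by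
    rw [codeM, hMd]
  have hF4 : (∀ x : F, x = 0 ∨ x = 1) ∨ 4 ≤ Fintype.card F := by
    rcases hm.eq_or_lt with rfl | hm
    · left
      intro x
      by_contra! hx
      have h1 := Finset.card_le_univ ({0, 1, x} : Finset F)
      rw [Finset.card_eq_three.2 ⟨0, 1, x, zero_ne_one, hx.1.symm, hx.2.symm, rfl⟩, hF', hq] at h1
      omega
    · right
      rw [hF', hq]
      calc 4 = 2 ^ 2 := rfl
        _ ≤ 2 ^ m := Nat.pow_le_pow_right (by norm_num) hm
  obtain ⟨h1, h2⟩ := hu.codeAut0_le_codeAutS hF4 (by rw [Fintype.card_fin, hF'])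
  have hbin : ∀ x : ZMod 2, x = 0 ∨ x = 1 := by decide
  have eMd := hu.nonempty_codeAutS_mulEquiv
  have eM : Nonempty (codeAutS (dualCode (conicCode fun i : Fin (q + 1) => b (β ^ (i : ℕ))) :
      Set (Fin (q + 1) → F)) ≃* generalSemilinearGroup 2 F) := by
    obtain ⟨e⟩ := eMd
    obtain ⟨e'⟩ := nonempty_codeAutS_mulEquiv_dualCode
      (conicCode fun i : Fin (q + 1) => b (β ^ (i : ℕ)))
    exact ⟨e'.symm.trans e⟩
  have eK : Nonempty (codeAutS (codeK q α : Set (Fin (q ^ 2 - 1) → ZMod 2)) ≃*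
      generalSemilinearGroup 2 F) := by
    rw [codeK_eq_kasamiModel hq hF' α b]
    exact nonempty_codeAutS_kasamiModel_mulEquiv hu h2 (powerEquiv hα (by rw [hE]) b)
  have eKd : Nonempty (codeAutS (codeKdual q α : Set (Fin (q ^ 2 - 1) → ZMod 2)) ≃*
      generalSemilinearGroup 2 F) := by
    obtain ⟨e⟩ := eK
    obtain ⟨e'⟩ := nonempty_codeAutS_mulEquiv_dualCode (codeK q α)
    exact ⟨e'.symm.trans e⟩
  refine ⟨?_, ?_, nonempty_codeAut_mulEquiv (codeAut0_le_codeAutS_of_binary hbin _) eK,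
    nonempty_codeAut_mulEquiv (codeAut0_le_codeAutS_of_binary hbin _) eKd, ?_, ?_⟩
  · rw [hMd]
    exact nonempty_codeAut_mulEquiv h1 eMd
  · rw [hM]
    exact nonempty_codeAut_mulEquiv h2 eM
  · rw [hMd]
    exact hu.nonempty_codeAutM_mulEquiv
  · rw [hM]
    obtain ⟨e⟩ := hu.nonempty_codeAutM_mulEquiv
    obtain ⟨e'⟩ := nonempty_codeAutM_mulEquiv_dualCode
      (conicCode fun i : Fin (q + 1) => b (β ^ (i : ℕ)))
    exact ⟨e'.symm.trans e⟩
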